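/- Let $N$ be a (Hausdorff, second countable, finite-dimensional) smooth manifold without boundary, let $K \subseteq N$ be compact, and let $X_1, \dots, X_d$ be smooth vector fields on $N$ with $\operatorname{supp} X_i \subseteq K$ and $[X_i, X_j] = 0$ for all $i, j$. Their flows $\phi^{X_i}$ define an action of $\mathbb{R}^d$ on the $C^*$-algebra $C_b^0(N)$ of bounded continuous complex-valued functions on $N$ (with the supremum norm) by $$\alpha_v(f) = f \circ \phi^{X_1}_{v_1} \circ \cdots \circ \phi^{X_d}_{v_d}, \qquad v \in \mathbb{R}^d.$$ Let $C_b^0(N)^\infty$ be the space of smooth vectors, i.e. of those $f \in C_b^0(N)$ for which $v \mapsto \alpha_v(f)$ is a smooth map $\mathbb{R}^d \to C_b^0(N)$. Let $\Theta$ be a linear operator on $\mathbb{R}^d$ that is skew-symmetric for the standard inner product, and for $f, g \in C_b^0(N)^\infty$ define the deformed product by the oscillating integral $$f \star g = \iint \alpha_{\Theta u}(f)\, \alpha_v(g)\, e^{2\pi i u \cdot v}\, du\, dv := \sum_{w \in \mathbb{Z}^d \times \mathbb{Z}^d} \iint \alpha_{\Theta u}(f)\, \alpha_v(g)\, \varphi_w(u,v)\,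 e^{2\pi i u \cdot v}\, du\, dv,$$ where $\varphi_w(z) = \varphi(z - w)$ and $0 \le \varphi \in C_c^\infty(\mathbb{R}^d \times \mathbb{R}^d)$ is any function with $\sum_w \varphi_w = 1$; the series converges unconditionally in $C_b^0(N)$ and its sum does not depend on $\varphi$. Let $q \in K$ with $X_i(q) = 0$ for all $i = 1, \dots, d$. Then $$\delta_q(f \star g) = f(q)\, g(q) = \delta_q(fg) \qquad \text{for all } f, g \in C_b^0(N)^\infty,$$ where $\delta_q : C_b^0(N) \to \mathbb{C}$, $\delta_q(f) = f(q)$, is the $\delta$-functional. The same holds for every $q \in N \setminus K$. -/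

import Mathlib

open scoped Manifold ContDiff BoundedContinuousFunction

namespace RieffelDeformation

noncomputable section

/-- `ℝ^d` with its standard inner product. -/
abbrev V (d : ℕ) : Type := EuclideanSpace ℝ (Fin d)

section Action

variable {n d : ℕ} {N : Type*} [TopologicalSpace N] [ChartedSpace (EuclideanSpace ℝ (Fin n)) N]

open Classical in
/-- The flow `φ^X_t(x)` of a vector field `X`: the value at time `t` of the integral curve
`γ : ℝ → N` of `X` with `γ 0 = x`. (For a complete smooth vector field on a Hausdorff manifold this
curve exists and is unique; if no such curve exists, the value is `x`.) -/
def flow (X : (x : N) → TangentSpace (𝓡 n) x) (t : ℝ) (x : N) : N :=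
  if h : ∃ γ : ℝ → N, γ 0 = x ∧ IsMIntegralCurve (I := 𝓡 n) γ X then h.choose t else x

/-- The composition `φ^{X_1}_{v_1} ∘ ⋯ ∘ φ^{X_d}_{v_d}`. -/
def jointFlow (X : Fin d → (x : N) → TangentSpace (𝓡 n) x) (v : V d) : N → N :=
  (List.ofFn fun i => flow (X i) (v i)).foldr (· ∘ ·) id

open Classical in
/-- `α_v(f) = f ∘ φ^{X_1}_{v_1} ∘ ⋯ ∘ φ^{X_d}_{v_d}` as an element of `C_b^0(N)`. (The composition
is continuous for complete smooth vector fields; if it were not, the value would be `0`.) -/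
def action (X : Fin d → (x : N) → TangentSpace (𝓡 n) x) (v : V d) (f : N →ᵇ ℂ) : N →ᵇ ℂ :=
  if h : Continuous (jointFlow X v) then f.compContinuous ⟨jointFlow X v, h⟩ else 0

/-- The smooth vectors `C_b^0(N)^∞`: those `f` whose orbit map `v ↦ α_v(f)` is smooth as a map from
`ℝ^d` to the Banach space `C_b^0(N)`. -/
def smoothVectors (X : Fin d → (x : N) → TangentSpace (𝓡 n) x) : Set (N →ᵇ ℂ) :=
  {f | ContDiff ℝ ∞ fun v : V d => action X v f}

end Action

section OscillatoryIntegral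

variable {d : ℕ} {A : Type*} [NormedAddCommGroup A] [NormedSpace ℂ A]

/-- The point of the lattice `ℤ^d × ℤ^d` in `ℝ^d × ℝ^d` with integer coordinates `w`. -/
def latticePoint (w : (Fin d → ℤ) × (Fin d → ℤ)) : V d × V d :=
  (WithLp.toLp 2 fun i => (w.1 i : ℝ), WithLp.toLp 2 fun i => (w.2 i : ℝ))

/-- The translates `φ_w(z) = φ(z - w)` of `φ ∈ C_c^∞(ℝ^d × ℝ^d)` by the points `w` of the lattice
`ℤ^d × ℤ^d` form a partition of unity. -/
structure IsPartitionGenerator (φ : V d × V d → ℝ) : Prop where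
  smooth : ContDiff ℝ ∞ φ
  hasCompactSupport : HasCompactSupport φ
  nonneg : ∀ z, 0 ≤ φ z
  hasSum_one : ∀ z, HasSum (fun w => φ (z - latticePoint w)) 1

/-- `a` is the value of the oscillating integral `∬ F(u, v) e^{2πi u⋅v} du dv`, that is,
`a = ∑_w ∬ F(u, v) φ_w(u, v) e^{2πi u⋅v} du dv` (unconditional convergence in `A`), for every
partition of unity `(φ_w)` by lattice translates of a compactly supported smooth function. -/
def HasOscIntegral (F : V d × V d → A) (a : A) : Prop :=
  ∀ φ : V d × V d → ℝ, IsPartitionGenerator φ →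
    HasSum (fun w => ∫ z : V d × V d,
      ((φ (z - latticePoint w) : ℂ) *
        Complex.exp (2 * Real.pi * Complex.I * ((inner ℝ z.1 z.2 : ℝ) : ℂ))) • F z) a

open Classical in
/-- The oscillating integral `∬ F(u, v) e^{2πi u⋅v} du dv` (`0` if it does not converge). -/
def oscIntegral (F : V d × V d → A) : A :=
  if h : ∃ a, HasOscIntegral F a then h.choose else 0

end OscillatoryIntegral

section Product

variable {n d : ℕ} {N : Type*} [TopologicalSpace N] [ChartedSpace (EuclideanSpace ℝ (Fin n)) N]

/-- The integrand `(u, v) ↦ α_{Θu}(f) α_v(g)` of the deformed product. -/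
def starIntegrand (X : Fin d → (x : N) → TangentSpace (𝓡 n) x) (Θ : V d →ₗ[ℝ] V d)
    (f g : N →ᵇ ℂ) (z : V d × V d) : N →ᵇ ℂ :=
  action X (Θ z.1) f * action X z.2 g

/-- The deformed product `f ⋆ g = ∬ α_{Θu}(f) α_v(g) e^{2πi u⋅v} du dv`. -/
def starProduct (X : Fin d → (x : N) → TangentSpace (𝓡 n) x) (Θ : V d →ₗ[ℝ] V d)
    (f g : N →ᵇ ℂ) : N →ᵇ ℂ :=
  oscIntegral (starIntegrand X Θ f g)

/-- The `δ`-functional `δ_q : C_b^0(N) → ℂ`, `f ↦ f(q)`. -/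
def delta (q : N) : (N →ᵇ ℂ) →L[ℂ] ℂ :=
  BoundedContinuousFunction.evalCLM ℂ q

end Product

end

end RieffelDeformation

namespace RieffelDeformation

section Flows

open Set Filter Topology Metric
open scoped NNReal

/-! ### Ordinary differential equations in a normed space. -/

section NormedSpaceODE

variable {E : Type*} [NormedAddCommGroup E] [NormedSpace ℝ E]

/-! All `X i` vanish at `q`, so every flow fixes `q`, and evaluation at `q` turns the integrand
`α_{Θu}(f) α_v(g)` into the constant `f(q) g(q)`. Since `δ_q` is a continuous linear functional, it
passes through the series and the integrals, and the claim reduces to the fact that the oscillating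
integral of the constant `1` is `1` (`regularizedIntegral_one`), which is Fourier inversion at the
origin.

Most of the work shows that the oscillating integral exists in `C_b^0(N)`, since otherwise the
definitions return a default value. This has a geometric half and an analytic half.

Geometry: compactly supported fields are complete with continuous flows, and vanishing brackets make
the flows commute (`flow_comm`), so the joint flow is an action of `ℝ^d`. Commutation is proved by
comparing, through Grönwall, a nearby trajectory of `X` with the first-order displacement of a given
one along `Y`. As each `α_v` is a contraction, the group law bounds every derivative of the orbit
map of a smooth vector by its value at `0` (`norm_iteratedFDeriv_action_le`).

Analysis: an integrand with bounded derivatives is integrated by parts against `e^{2πi u⋅v}` until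
an integrable weight appears. Dominated convergence then shows that any cutoffs with uniformly
bounded derivatives, eventually `1` near each point, give the same limit
(`tendsto_integral_cutoff`). Finite partial sums of a lattice partition are such cutoffs, which
yields unconditional convergence and independence of the partition; products of dilated bumps are
such cutoffs too, which allows the value at `1` to be computed. -/

theorem exists_local_flow_lipschitzOnWith [CompleteSpace E] {v : E → E} {x₀ : E}
    (hv : ContDiffAt ℝ 1 v x₀) {W : Set E} (hW : W ∈ 𝓝 x₀) :
    ∃ r > (0 : ℝ), ∃ ε > (0 : ℝ), ∃ α : E → ℝ → E, ∃ C : ℝ≥0,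
      (∀ x ∈ ball x₀ r, α x 0 = x ∧ ∀ t ∈ Ioo (-ε) ε, HasDerivAt (α x) (v (α x t)) t ∧ α x t ∈ W) ∧
      ∀ t ∈ Ioo (-ε) ε, LipschitzOnWith C (α · t) (ball x₀ r) := by
  obtain ⟨ε, hε, a, r, L, K, hr, hpl⟩ := IsPicardLindelof.of_contDiffAt_one hv
  obtain ⟨α, hα, C, hC⟩ :=
    (hpl 0).exists_forall_mem_closedBall_eq_hasDerivWithinAt_lipschitzOnWith
  have hcont : ContinuousOn (Function.uncurry α) (closedBall x₀ r ×ˢ Icc (0 - ε) (0 + ε)) :=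
    continuousOn_prod_of_continuousOn_lipschitzOnWith _ C
      (fun x hx ↦ HasDerivWithinAt.continuousOn (hα x hx).2) hC
  have hat : ContinuousAt (Function.uncurry α) (x₀, 0) :=
    hcont.continuousAt (prod_mem_nhds (closedBall_mem_nhds _ hr)
      (Icc_mem_nhds (by linarith) (by linarith)))
  have hx₀ : Function.uncurry α (x₀, 0) = x₀ := (hα x₀ (mem_closedBall_self hr.le)).1
  -- Joint continuity at `(x₀, 0)` allows radius and time to be shrunk until all trajectories stay
  -- in `W`.
  have hpre : Function.uncurry α ⁻¹' W ∈ 𝓝 (x₀, (0 : ℝ)) := hat.preimage_mem_nhds (by rwa [hx₀])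
  obtain ⟨δ, hδ, hδW⟩ := Metric.mem_nhds_iff.1 hpre
  have hmem : ∀ x ∈ ball x₀ (min r δ), x ∈ closedBall x₀ r := fun x hx ↦
    ball_subset_closedBall (ball_subset_ball (min_le_left _ _) hx)
  have htime : ∀ t ∈ Ioo (-(min ε δ)) (min ε δ), t ∈ Ioo (0 - ε) (0 + ε) := fun t ht ↦
    ⟨by linarith [ht.1, min_le_left ε δ], by linarith [ht.2, min_le_left ε δ]⟩
  refine ⟨min r δ, lt_min hr hδ, min ε δ, lt_min hε hδ, α, C,
    fun x hx ↦ ⟨(hα x (hmem x hx)).1, fun t ht ↦ ⟨?_, ?_⟩⟩, fun t ht ↦ ?_⟩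
  · exact ((hα x (hmem x hx)).2 t (Ioo_subset_Icc_self (htime t ht))).hasDerivAt
      (Icc_mem_nhds (htime t ht).1 (htime t ht).2)
  · refine hδW (a := (x, t)) ?_
    rw [← ball_prod_same]
    refine ⟨ball_subset_ball (min_le_right _ _) hx, ?_⟩
    rw [mem_ball, Real.dist_eq, sub_zero, abs_lt]
    exact ⟨by linarith [ht.1, min_le_right ε δ], by linarith [ht.2, min_le_right ε δ]⟩
  · exact (hC t (Ioo_subset_Icc_self (htime t ht))).mono hmem

/-- Linearity of the Grönwall bound in `δ` and `ε` is what lets an initial error `o(h)` and a defect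
`O(h²)` combine to a final error `o(h)`. -/
theorem exists_gronwallBound_eq_add (K a : ℝ) (hK : 0 ≤ K) :
    ∃ A B : ℝ, ∀ δ ε : ℝ, gronwallBound δ K ε a = A * δ + B * ε := by
  rcases hK.eq_or_lt with rfl | hK
  · exact ⟨1, a, fun δ ε ↦ by rw [gronwallBound_K0]; ring⟩
  · exact ⟨Real.exp (K * a), (Real.exp (K * a) - 1) / K, fun δ ε ↦ by
      rw [gronwallBound_of_K_ne_0 hK.ne']; ring⟩

/-- The flow of `V` maps curves tangent to `W` to curves tangent to `W` if `[V, W] = 0`. -/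
theorem exists_nhds_hasDerivAt_of_lieBracket_eq_zero {V W : E → E} {x₀ : E}
    (hV : ContDiffAt ℝ 2 V x₀) (hW : ContDiffAt ℝ 1 W x₀)
    (hVW : ∀ᶠ y in 𝓝 x₀, VectorField.lieBracket ℝ V W y = 0) :
    ∃ B ∈ 𝓝 x₀, ∀ (a : ℝ) (x : ℝ → ℝ → E), 0 ≤ a →
      (∀ᶠ h in 𝓝 (0 : ℝ), ∀ t ∈ Icc 0 a, HasDerivAt (x h) (V (x h t)) t ∧ x h t ∈ B) →
      HasDerivAt (fun h ↦ x h 0) (W (x 0 0)) 0 → HasDerivAt (fun h ↦ x h a) (W (x 0 a)) 0 := by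
  obtain ⟨K, s₁, hs₁, hK⟩ := (hV.of_le (by norm_num)).exists_lipschitzOnWith
  have hfd : ContDiffAt ℝ 1 (fderiv ℝ V) x₀ := hV.fderiv_right (by norm_num)
  obtain ⟨K₂, s₂, hs₂, hK₂⟩ := hfd.exists_lipschitzOnWith
  have hdV : ∀ᶠ y in 𝓝 x₀, DifferentiableAt ℝ V y :=
    (hV.eventually (by simp)).mono fun y hy ↦ hy.differentiableAt (by simp)
  have hdW : ∀ᶠ y in 𝓝 x₀, DifferentiableAt ℝ W y :=
    (hW.eventually (by simp)).mono fun y hy ↦ hy.differentiableAt (by simp)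
  have hbW : ∀ᶠ y in 𝓝 x₀, ‖W y‖ < ‖W x₀‖ + 1 :=
    hW.continuousAt.norm.eventually_lt_const (by linarith)
  obtain ⟨ρ, hρ, hball⟩ := Metric.mem_nhds_iff.1
    (Filter.inter_mem (Filter.inter_mem hs₁ hs₂) (hdV.and (hdW.and (hbW.and hVW))))
  set M : ℝ := ‖W x₀‖ + 1 with hM
  have hMpos : 0 < M := by positivity
  -- Half the radius leaves room for the displaced curve `x 0 t + h • W (x 0 t)` to stay in the ball
  -- where all estimates hold.
  refine ⟨ball x₀ (ρ / 2), ball_mem_nhds _ (by positivity), fun a x ha hx h0 ↦ ?_⟩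
  have hx0 : ∀ t ∈ Icc 0 a, HasDerivAt (x 0) (V (x 0 t)) t ∧ x 0 t ∈ ball x₀ (ρ / 2) :=
    hx.self_of_nhds
  have hhalf : ball x₀ (ρ / 2) ⊆ ball x₀ ρ := ball_subset_ball (by linarith)
  obtain ⟨A, C, hAC⟩ := exists_gronwallBound_eq_add K a K.2
  have hsmall : ∀ᶠ h : ℝ in 𝓝 0, |h| * M < ρ / 2 := by
    have : Tendsto (fun h : ℝ ↦ |h| * M) (𝓝 0) (𝓝 (|0| * M)) := by
      exact (continuous_abs.mul continuous_const).tendsto 0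
    rw [abs_zero, zero_mul] at this
    exact this.eventually_lt_const (by positivity)
  have key : ∀ᶠ h : ℝ in 𝓝 0, ‖x h a - x 0 a - h • W (x 0 a)‖ ≤
      A * ‖x h 0 - x 0 0 - h • W (x 0 0)‖ + C * (K₂ * (M * M) * (h * h)) := by
    filter_upwards [hx, hsmall] with h hxh hh
    have hz : ∀ t ∈ Icc 0 a, HasDerivAt (fun t ↦ x 0 t + h • W (x 0 t))
        (V (x 0 t) + h • fderiv ℝ W (x 0 t) (V (x 0 t))) t := fun t ht ↦ by
      have h1 := (hball (hhalf (hx0 t ht).2)).2.2.1.hasFDerivAt.comp_hasDerivAt t (hx0 t ht).1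
      exact (hx0 t ht).1.add (h1.const_smul h)
    have hk : ∀ t ∈ Icc 0 a, ‖h • W (x 0 t)‖ ≤ |h| * M := fun t ht ↦ by
      rw [norm_smul, Real.norm_eq_abs]
      exact mul_le_mul_of_nonneg_left (hball (hhalf (hx0 t ht).2)).2.2.2.1.le (abs_nonneg h)
    have hzmem : ∀ t ∈ Icc 0 a, x 0 t + h • W (x 0 t) ∈ ball x₀ ρ := fun t ht ↦ by
      have h1 := (hx0 t ht).2
      rw [mem_ball, dist_eq_norm] at h1 ⊢
      calc ‖x 0 t + h • W (x 0 t) - x₀‖ = ‖(x 0 t - x₀) + h • W (x 0 t)‖ := by congr 1; abel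
        _ ≤ ‖x 0 t - x₀‖ + ‖h • W (x 0 t)‖ := norm_add_le _ _
        _ < ρ := by linarith [hk t ht]
    -- The displaced curve solves the equation of `V` up to `O(h²)`: the zero bracket replaces
    -- `DW(V)` by `DV(W)`, so the defect is the first-order Taylor remainder of `V`, controlled by
    -- the Lipschitz constant of `DV`.
    have herr : ∀ t ∈ Icc 0 a,
        dist (V (x 0 t) + h • fderiv ℝ W (x 0 t) (V (x 0 t))) (V (x 0 t + h • W (x 0 t))) ≤
          K₂ * (M * M) * (h * h) := fun t ht ↦ by
      set y := x 0 t with hy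
      have hyb : y ∈ ball x₀ ρ := hhalf (hx0 t ht).2
      have hbr : fderiv ℝ W y (V y) = fderiv ℝ V y (W y) := by
        have := (hball hyb).2.2.2.2
        rwa [VectorField.lieBracket, sub_eq_zero] at this
      have hseg : segment ℝ y (y + h • W y) ⊆ ball x₀ ρ :=
        (convex_ball x₀ ρ).segment_subset hyb (hzmem t ht)
      have hmv := (convex_segment (𝕜 := ℝ) y (y + h • W y)).norm_image_sub_le_of_norm_fderiv_le'
        (f := V) (φ := fderiv ℝ V y) (C := K₂ * (|h| * M)) (fun z hz' ↦ (hball (hseg hz')).2.1)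
        (fun z hz' ↦ by
          have h1 := hK₂.dist_le_mul z (hball (hseg hz')).1.2 y (hball hyb).1.2
          rw [dist_eq_norm] at h1
          refine h1.trans (mul_le_mul_of_nonneg_left ?_ K₂.2)
          have h2 : dist z y ≤ dist (y + h • W y) y := by
            obtain ⟨θ, hθ, rfl⟩ := (segment_eq_image' ℝ y (y + h • W y)) ▸ hz'
            simp only [dist_eq_norm, add_sub_cancel_left, norm_smul, Real.norm_eq_abs,
              abs_of_nonneg hθ.1]
            exact mul_le_of_le_one_left (by positivity) hθ.2
          refine h2.trans ?_
          rw [dist_eq_norm, add_sub_cancel_left]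
          exact hk t ht)
        (left_mem_segment ℝ _ _) (right_mem_segment ℝ _ _)
      rw [add_sub_cancel_left, map_smul] at hmv
      rw [dist_comm, dist_eq_norm, hbr]
      calc _ = ‖V (y + h • W y) - V y - h • (fderiv ℝ V y) (W y)‖ := by congr 1; abel
        _ ≤ _ := hmv
        _ ≤ K₂ * (|h| * M) * (|h| * M) := by gcongr; exact hk t ht
        _ = K₂ * (M * M) * (|h| * |h|) := by ring
        _ = _ := by rw [abs_mul_abs_self]
    have hG := dist_le_of_approx_trajectories_ODE_of_mem (v := fun _ ↦ V)
      (s := fun _ ↦ ball x₀ ρ) (K := K) (a := 0) (b := a) (εf := 0)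
      (fun t _ ↦ hK.mono fun z hz' ↦ (hball hz').1.1)
      (f := x h) (f' := fun t ↦ V (x h t))
      (fun t ht ↦ (hxh t ht).1.continuousAt.continuousWithinAt)
      (fun t ht ↦ (hxh t (Ico_subset_Icc_self ht)).1.hasDerivWithinAt)
      (fun t ht ↦ (dist_self _).le) (fun t ht ↦ hhalf (hxh t (Ico_subset_Icc_self ht)).2)
      (fun t ht ↦ (hz t ht).continuousAt.continuousWithinAt)
      (fun t ht ↦ (hz t (Ico_subset_Icc_self ht)).hasDerivWithinAt)
      (fun t ht ↦ herr t (Ico_subset_Icc_self ht))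
      (fun t ht ↦ hzmem t (Ico_subset_Icc_self ht)) le_rfl a (right_mem_Icc.2 ha)
    rw [sub_zero, hAC, zero_add] at hG
    simpa only [dist_eq_norm, sub_add_eq_sub_sub] using hG
  rw [hasDerivAt_iff_isLittleO] at h0 ⊢
  simp only [sub_zero] at h0 ⊢
  have hsq : (fun h : ℝ ↦ h * h) =o[𝓝 0] fun h ↦ h := by
    simpa only [pow_two] using Asymptotics.isLittleO_pow_id (𝕜 := ℝ) one_lt_two
  have hsum : (fun h : ℝ ↦ A * ‖x h 0 - x 0 0 - h • W (x 0 0)‖ + C * (K₂ * (M * M) * (h * h)))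
      =o[𝓝 0] fun h ↦ h :=
    (h0.norm_left.const_mul_left A).add ((hsq.const_mul_left _).const_mul_left C)
  exact (Asymptotics.IsBigO.of_bound' (key.mono fun h hh ↦ hh.trans (le_abs_self _))).trans_isLittleO
    hsum

end NormedSpaceODE

/-! ### Vector fields and integral curves in charts; local flows. -/

section Charts

variable {n : ℕ} {N : Type*} [TopologicalSpace N] [ChartedSpace (EuclideanSpace ℝ (Fin n)) N]

/-- The curve `c` has velocity `X (c t)` at time `t`. -/
def IsTangentAt (X : (x : N) → TangentSpace (𝓡 n) x) (c : ℝ → N) (t : ℝ) : Prop :=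
  HasMFDerivAt 𝓘(ℝ, ℝ) (𝓡 n) c t ((1 : ℝ →L[ℝ] ℝ).smulRight (X (c t)))

/-- The expression of the vector field `X` in the chart at `p`. -/
noncomputable def chartVectorField (p : N) (X : (x : N) → TangentSpace (𝓡 n) x)
    (y : EuclideanSpace ℝ (Fin n)) : EuclideanSpace ℝ (Fin n) :=
  VectorField.mpullback 𝓘(ℝ, EuclideanSpace ℝ (Fin n)) (𝓡 n) (extChartAt (𝓡 n) p).symm X y

theorem IsTangentAt.congr {X : (x : N) → TangentSpace (𝓡 n) x} {c c' : ℝ → N} {t : ℝ} (hc : IsTangentAt X c t) (h : c' =ᶠ[𝓝 t] c) :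
    IsTangentAt X c' t := by
  have h3 := HasMFDerivAt.congr_of_eventuallyEq hc h
  unfold IsTangentAt
  rwa [h.self_of_nhds]

variable [IsManifold (𝓡 n) ∞ N] {p : N} {X Y : (x : N) → TangentSpace (𝓡 n) x}

theorem contMDiffAt_extChartAt_symm {y : EuclideanSpace ℝ (Fin n)}
    (hy : y ∈ (extChartAt (𝓡 n) p).target) :
    ContMDiffAt 𝓘(ℝ, EuclideanSpace ℝ (Fin n)) (𝓡 n) ∞ (extChartAt (𝓡 n) p).symm y :=
  (contMDiffOn_extChartAt_symm p).contMDiffAt ((isOpen_extChartAt_target p).mem_nhds hy)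

theorem isInvertible_mfderiv_extChartAt_symm {y : EuclideanSpace ℝ (Fin n)}
    (hy : y ∈ (extChartAt (𝓡 n) p).target) :
    (mfderiv 𝓘(ℝ, EuclideanSpace ℝ (Fin n)) (𝓡 n) (extChartAt (𝓡 n) p).symm y).IsInvertible := by
  have : IsManifold (𝓡 n) 1 N := IsManifold.of_le (n := ∞) (by simp)
  have := isInvertible_mfderivWithin_extChartAt_symm (I := 𝓡 n) hy
  rwa [ModelWithCorners.range_eq_univ, mfderivWithin_univ] at this

theorem contDiffAt_chartVectorField {y : EuclideanSpace ℝ (Fin n)}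
    (hX : ContMDiff (𝓡 n) (𝓡 n).tangent ∞ (fun x => (⟨x, X x⟩ : TangentBundle (𝓡 n) N)))
    (hy : y ∈ (extChartAt (𝓡 n) p).target) : ContDiffAt ℝ ∞ (chartVectorField p X) y := by
  have : IsManifold (𝓡 n) 1 N := IsManifold.of_le (n := ∞) (by simp)
  exact contMDiffAt_vectorSpace_iff_contDiffAt.1 (ContMDiffAt.mpullback_vectorField_preimage
    (hX _) (contMDiffAt_extChartAt_symm hy) (isInvertible_mfderiv_extChartAt_symm hy) (by simp))

/-- The bracket is natural under pullback by the inverse chart, a local diffeomorphism. -/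
theorem lieBracket_chartVectorField_eq_zero {y : EuclideanSpace ℝ (Fin n)}
    (hX : ContMDiff (𝓡 n) (𝓡 n).tangent ∞ (fun x => (⟨x, X x⟩ : TangentBundle (𝓡 n) N)))
    (hY : ContMDiff (𝓡 n) (𝓡 n).tangent ∞ (fun x => (⟨x, Y x⟩ : TangentBundle (𝓡 n) N)))
    (hXY : ∀ x, VectorField.mlieBracket (𝓡 n) X Y x = 0)
    (hy : y ∈ (extChartAt (𝓡 n) p).target) :
    VectorField.lieBracket ℝ (chartVectorField p X) (chartVectorField p Y) y = 0 := by
  have h2 : minSmoothness ℝ 2 ≤ (∞ : WithTop ℕ∞) := by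
    rw [minSmoothness_of_isRCLikeNormedField]
    exact WithTop.coe_le_coe.2 (le_top : (2 : ℕ∞) ≤ ⊤)
  have : IsManifold (𝓡 n) (minSmoothness ℝ 2) N := IsManifold.of_le h2
  have h := VectorField.mpullback_mlieBracket (𝕜 := ℝ) (I := 𝓘(ℝ, EuclideanSpace ℝ (Fin n)))
    (I' := 𝓡 n) (n := ∞) (f := (extChartAt (𝓡 n) p).symm) (x₀ := y)
    ((hX _).mdifferentiableAt (by simp)) ((hY _).mdifferentiableAt (by simp))
    (contMDiffAt_extChartAt_symm hy) h2
  have h3 := congrFun (VectorField.mlieBracketWithin_eq_lieBracketWithin (𝕜 := ℝ)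
    (V := chartVectorField p X) (W := chartVectorField p Y) (s := univ)) y
  rw [VectorField.lieBracketWithin_univ] at h3
  refine (h3.symm.trans h.symm).trans ?_
  exact (congrArg _ (hXY _)).trans (ContinuousLinearMap.map_zero _)

theorem IsTangentAt.hasDerivAt_extChartAt {c : ℝ → N} {t : ℝ} (hc : IsTangentAt X c t)
    (ht : c t ∈ (extChartAt (𝓡 n) p).source) :
    HasDerivAt (extChartAt (𝓡 n) p ∘ c) (chartVectorField p X (extChartAt (𝓡 n) p (c t))) t := by
  have : IsManifold (𝓡 n) 1 N := IsManifold.of_le (n := ∞) (by simp)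
  have h1 : HasMFDerivAt (𝓡 n) 𝓘(ℝ, EuclideanSpace ℝ (Fin n)) (extChartAt (𝓡 n) p) (c t)
      (mfderiv (𝓡 n) 𝓘(ℝ, EuclideanSpace ℝ (Fin n)) (extChartAt (𝓡 n) p) (c t)) :=
    (mdifferentiableAt_extChartAt (by simpa using ht)).hasMFDerivAt
  -- Tangent spaces are retyped as the model space, so that the manifold derivative can be handled
  -- as an ordinary one.
  let A : EuclideanSpace ℝ (Fin n) →L[ℝ] EuclideanSpace ℝ (Fin n) :=
    mfderiv (𝓡 n) 𝓘(ℝ, EuclideanSpace ℝ (Fin n)) (extChartAt (𝓡 n) p) (c t)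
  let w : EuclideanSpace ℝ (Fin n) := X (c t)
  have h2 : HasFDerivAt (extChartAt (𝓡 n) p ∘ c) (A.comp ((1 : ℝ →L[ℝ] ℝ).smulRight w)) t :=
    (h1.comp t hc).hasFDerivAt
  have h3 : HasDerivAt (extChartAt (𝓡 n) p ∘ c) (A w) t := by
    simpa using h2.hasDerivAt
  have hinv := isInvertible_mfderiv_extChartAt_symm ((extChartAt (𝓡 n) p).map_source ht)
  have hcomp := mfderivWithin_extChartAt_symm_comp_mfderiv_extChartAt' (I := 𝓡 n) ht
  rw [ModelWithCorners.range_eq_univ, mfderivWithin_univ] at hcomp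
  have hw : (X ((extChartAt (𝓡 n) p).symm (extChartAt (𝓡 n) p (c t))) :
      EuclideanSpace ℝ (Fin n)) = w :=
    congrArg (fun x ↦ (X x : EuclideanSpace ℝ (Fin n))) ((extChartAt (𝓡 n) p).left_inv ht)
  have h4 : chartVectorField p X (extChartAt (𝓡 n) p (c t)) = A w :=
    hinv.inverse_apply_eq.2 (hw.trans (congrArg (fun L ↦ L (X (c t))) hcomp).symm)
  rwa [h4]

theorem isTangentAt_extChartAt_symm_comp {y : ℝ → EuclideanSpace ℝ (Fin n)} {t : ℝ}
    (hy : HasDerivAt y (chartVectorField p X (y t)) t) (ht : y t ∈ (extChartAt (𝓡 n) p).target) :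
    IsTangentAt X ((extChartAt (𝓡 n) p).symm ∘ y) t := by
  have : IsManifold (𝓡 n) 1 N := IsManifold.of_le (n := ∞) (by simp)
  have h1 := ((contMDiffAt_extChartAt_symm ht).mdifferentiableAt (by simp)).hasMFDerivAt
  have h2 := h1.comp t hy.hasFDerivAt.hasMFDerivAt
  refine h2.congr_mfderiv ?_
  let B : EuclideanSpace ℝ (Fin n) →L[ℝ] EuclideanSpace ℝ (Fin n) :=
    mfderiv 𝓘(ℝ, EuclideanSpace ℝ (Fin n)) (𝓡 n) (extChartAt (𝓡 n) p).symm (y t)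
  let w : EuclideanSpace ℝ (Fin n) := X ((extChartAt (𝓡 n) p).symm (y t))
  have h5 : B (chartVectorField p X (y t)) = w :=
    (isInvertible_mfderiv_extChartAt_symm ht).self_apply_inverse
      (X ((extChartAt (𝓡 n) p).symm (y t)))
  have h6 : B.comp (ContinuousLinearMap.toSpanSingleton ℝ (chartVectorField p X (y t))) =
      (1 : ℝ →L[ℝ] ℝ).smulRight w := by
    ext1
    simp [h5]
  exact h6

end Charts

section LocalFlow

variable {n : ℕ} {N : Type*} [TopologicalSpace N] [ChartedSpace (EuclideanSpace ℝ (Fin n)) N]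
  [IsManifold (𝓡 n) ∞ N] {X Y : (x : N) → TangentSpace (𝓡 n) x}

/-- The normed-space results read in one chart. The last clause is infinitesimal commutation; times
are nonnegative there because the Grönwall estimate runs forward. Taking `Y = X` gives the bare
local flow. -/
theorem exists_local_flow_of_mlieBracket_eq_zero
    (hX : ContMDiff (𝓡 n) (𝓡 n).tangent ∞ (fun x => (⟨x, X x⟩ : TangentBundle (𝓡 n) N)))
    (hY : ContMDiff (𝓡 n) (𝓡 n).tangent ∞ (fun x => (⟨x, Y x⟩ : TangentBundle (𝓡 n) N)))
    (hXY : ∀ x, VectorField.mlieBracket (𝓡 n) X Y x = 0) (p : N) :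
    ∃ U : Set N, IsOpen U ∧ p ∈ U ∧ ∃ ε > (0 : ℝ), ∃ β : N → ℝ → N,
      (∀ x ∈ U, β x 0 = x ∧ IsMIntegralCurveOn (I := 𝓡 n) (β x) X (Ioo (-ε) ε)) ∧
      (∀ t ∈ Ioo (-ε) ε, ContinuousOn (β · t) U) ∧
      ∀ t ∈ Ico 0 ε, ∀ c : ℝ → N, c 0 ∈ U → IsTangentAt Y c 0 →
        IsTangentAt Y (fun h ↦ β (c h) t) 0 := by
  set e := extChartAt (𝓡 n) p with he
  have hp : e p ∈ e.target := e.map_source (mem_extChartAt_source p)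
  have htarget : e.target ∈ 𝓝 (e p) := (isOpen_extChartAt_target p).mem_nhds hp
  obtain ⟨B, hB, hBprop⟩ := exists_nhds_hasDerivAt_of_lieBracket_eq_zero
    ((contDiffAt_chartVectorField hX hp).of_le (WithTop.coe_le_coe.2 (le_top : (2 : ℕ∞) ≤ ⊤)))
    ((contDiffAt_chartVectorField hY hp).of_le (by simp))
    (by filter_upwards [htarget] with y hy
        exact lieBracket_chartVectorField_eq_zero hX hY hXY hy)
  obtain ⟨r, hr, ε, hε, α, C, hα, hC⟩ := exists_local_flow_lipschitzOnWith
    ((contDiffAt_chartVectorField hX hp).of_le (by simp)) (Filter.inter_mem hB htarget)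
  refine ⟨e.source ∩ e ⁻¹' ball (e p) r, ?_, ⟨mem_extChartAt_source p, mem_ball_self hr⟩,
    ε, hε, fun x t ↦ e.symm (α (e x) t), fun x hx ↦ ⟨?_, fun t ht ↦ ?_⟩, fun t ht ↦ ?_,
    fun t ht c hc0 hc ↦ ?_⟩
  · exact (continuousOn_extChartAt p).isOpen_inter_preimage (isOpen_extChartAt_source p) isOpen_ball
  · simp only [(hα _ hx.2).1]
    exact e.left_inv hx.1
  · have h := (hα _ hx.2).2 t ht
    exact (isTangentAt_extChartAt_symm_comp h.1 h.2.2).hasMFDerivWithinAt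
  · refine (continuousOn_extChartAt_symm p).comp ((hC t ht).continuousOn.comp
      ((continuousOn_extChartAt p).mono inter_subset_left) fun x hx ↦ hx.2) fun x hx ↦ ?_
    exact ((hα _ hx.2).2 t ht).2.2
  · have hopen : IsOpen (e.source ∩ e ⁻¹' ball (e p) r) :=
      (continuousOn_extChartAt p).isOpen_inter_preimage (isOpen_extChartAt_source p) isOpen_ball
    have hcont : ContinuousAt c 0 := HasMFDerivAt.continuousAt hc
    have hev : ∀ᶠ h in 𝓝 (0 : ℝ), c h ∈ e.source ∩ e ⁻¹' ball (e p) r :=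
      hcont.preimage_mem_nhds (hopen.mem_nhds hc0)
    have htime : ∀ s ∈ Icc 0 t, s ∈ Ioo (-ε) ε := fun s hs ↦
      ⟨by linarith [hs.1], hs.2.trans_lt ht.2⟩
    have hder := hBprop t (fun h s ↦ α (e (c h)) s) ht.1
      (by filter_upwards [hev] with h hh s hs
          exact ⟨((hα _ hh.2).2 s (htime s hs)).1, ((hα _ hh.2).2 s (htime s hs)).2.1⟩)
      (by
        have h1 := hc.hasDerivAt_extChartAt hc0.1
        simp only [(hα _ hc0.2).1]
        refine h1.congr_of_eventuallyEq ?_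
        filter_upwards [hev] with h hh
        exact (hα _ hh.2).1)
    exact isTangentAt_extChartAt_symm_comp hder ((hα _ hc0.2).2 t (htime t ⟨ht.1, le_rfl⟩)).2.2

end LocalFlow

/-! ### Completeness of compactly supported vector fields. -/

section GlobalFlow

variable {n : ℕ} {N : Type*} [TopologicalSpace N] [T2Space N]
  [ChartedSpace (EuclideanSpace ℝ (Fin n)) N] [IsManifold (𝓡 n) ∞ N]
  {X Y : (x : N) → TangentSpace (𝓡 n) x} {K : Set N}

/-- Turns local lifespans into one uniform time on the support; used for existence, continuity and
commutation alike. -/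
theorem _root_.IsCompact.exists_pos_forall_of_antitone {α : Type*} [TopologicalSpace α] {K : Set α}
    (hK : IsCompact K)
    {P : ℝ → α → Prop} (hP : ∀ x δ δ', δ' ≤ δ → P δ x → P δ' x)
    (h : ∀ p, ∃ δ > 0, ∀ᶠ x in 𝓝 p, P δ x) : ∃ δ > 0, ∀ x ∈ K, P δ x := by
  refine hK.induction_on (p := fun s ↦ ∃ δ > 0, ∀ x ∈ s, P δ x) ⟨1, one_pos, by simp⟩ ?_ ?_ ?_
  · rintro s t hst ⟨δ, hδ, h⟩
    exact ⟨δ, hδ, fun x hx ↦ h x (hst hx)⟩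
  · rintro s t ⟨δ, hδ, h⟩ ⟨δ', hδ', h'⟩
    refine ⟨min δ δ', lt_min hδ hδ', ?_⟩
    rintro x (hx | hx)
    · exact hP x _ _ (min_le_left _ _) (h x hx)
    · exact hP x _ _ (min_le_right _ _) (h' x hx)
  · intro x _
    obtain ⟨δ, hδ, h⟩ := h x
    exact ⟨_, mem_nhdsWithin_of_mem_nhds h, δ, hδ, fun x hx ↦ hx⟩

theorem eq_of_isMIntegralCurve
    (hX : ContMDiff (𝓡 n) (𝓡 n).tangent ∞ (fun x => (⟨x, X x⟩ : TangentBundle (𝓡 n) N)))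
    {γ γ' : ℝ → N} (hγ : IsMIntegralCurve (I := 𝓡 n) γ X)
    (hγ' : IsMIntegralCurve (I := 𝓡 n) γ' X) (h : γ 0 = γ' 0) : γ = γ' := by
  have : IsManifold (𝓡 n) 1 N := IsManifold.of_le (n := ∞) (by simp)
  exact isMIntegralCurve_Ioo_eq_of_contMDiff_boundaryless (t₀ := 0) (hX.of_le (by simp)) hγ hγ' h

omit [T2Space N] [IsManifold (𝓡 n) ∞ N] in
theorem eq_zero_of_notMem (hsupp : closure {x | X x ≠ 0} ⊆ K) {x : N} (hx : x ∉ K) : X x = 0 := by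
  by_contra h
  exact hx (hsupp (subset_closure h))

/-- A compactly supported smooth vector field is complete. -/
theorem exists_isMIntegralCurve_of_support_subset
    (hX : ContMDiff (𝓡 n) (𝓡 n).tangent ∞ (fun x => (⟨x, X x⟩ : TangentBundle (𝓡 n) N)))
    (hK : IsCompact K) (hsupp : closure {x | X x ≠ 0} ⊆ K) (x : N) :
    ∃ γ : ℝ → N, γ 0 = x ∧ IsMIntegralCurve (I := 𝓡 n) γ X := by
  have : IsManifold (𝓡 n) 1 N := IsManifold.of_le (n := ∞) (by simp)
  obtain ⟨δ, hδ, h⟩ := hK.exists_pos_forall_of_antitone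
    (P := fun δ x ↦ ∃ γ : ℝ → N, γ 0 = x ∧ IsMIntegralCurveOn (I := 𝓡 n) γ X (Ioo (-δ) δ))
    (fun x δ δ' hδ ⟨γ, h0, hγ⟩ ↦ ⟨γ, h0, hγ.mono (Ioo_subset_Ioo (by linarith) hδ)⟩)
    (fun p ↦ by
      obtain ⟨U, hU, hp, ε, hε, β, hβ, -⟩ := exists_local_flow_of_mlieBracket_eq_zero hX hX
        (fun x ↦ by rw [VectorField.mlieBracket_self]; rfl) p
      refine ⟨ε, hε, ?_⟩
      filter_upwards [hU.mem_nhds hp] with x hx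
      exact ⟨β x, hβ x hx⟩)
  -- A lifespan `δ` common to all starting points forces completeness; off `K` the constant curves
  -- serve.
  refine exists_isMIntegralCurve_of_isMIntegralCurveOn (hX.of_le (by simp)) hδ (fun x ↦ ?_) x
  by_cases hx : x ∈ K
  · exact h x hx
  · exact ⟨fun _ ↦ x, rfl,
      (isMIntegralCurve_const (eq_zero_of_notMem hsupp hx)).isMIntegralCurveOn _⟩

end GlobalFlow

/-! ### Group law, continuity and commutation of flows. -/

section Flow

variable {n : ℕ} {N : Type*} [TopologicalSpace N]
  [ChartedSpace (EuclideanSpace ℝ (Fin n)) N]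
  {X Y : (x : N) → TangentSpace (𝓡 n) x} {K : Set N}

theorem flow_spec (hex : ∀ x, ∃ γ : ℝ → N, γ 0 = x ∧ IsMIntegralCurve (I := 𝓡 n) γ X) (x : N) :
    flow X 0 x = x ∧ IsMIntegralCurve (I := 𝓡 n) (fun t ↦ flow X t x) X := by
  have h : ∀ t, flow X t x = (hex x).choose t := fun t ↦ dif_pos (hex x)
  refine ⟨(h 0).trans (hex x).choose_spec.1, ?_⟩
  rw [funext h]
  exact (hex x).choose_spec.2

theorem IsTangentAt.comp_sub {c : ℝ → N} (hc : IsTangentAt X c 0) (t₀ : ℝ) :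
    IsTangentAt X (fun t ↦ c (t - t₀)) t₀ := by
  have h1 : HasMFDerivAt 𝓘(ℝ, ℝ) 𝓘(ℝ, ℝ) (fun t : ℝ ↦ t - t₀) t₀ (ContinuousLinearMap.id ℝ ℝ) :=
    ((hasFDerivAt_id t₀).sub_const t₀).hasMFDerivAt
  have h2 : HasMFDerivAt 𝓘(ℝ, ℝ) (𝓡 n) c (t₀ - t₀)
      ((1 : ℝ →L[ℝ] ℝ).smulRight (X (c (t₀ - t₀)))) := by
    rw [sub_self]; exact hc
  exact h2.comp (f := fun t : ℝ ↦ t - t₀) t₀ h1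

/-- For `m > t / δ` the time `t` is a sum of `m` steps `t / m`, each in `[0, δ)`. -/
theorem of_add_of_Ico {P : ℝ → Prop} (hadd : ∀ s t, P s → P t → P (s + t)) {δ : ℝ} (hδ : 0 < δ)
    (h : ∀ t ∈ Ico 0 δ, P t) {t : ℝ} (ht : 0 ≤ t) : P t := by
  obtain ⟨m, hm⟩ := exists_nat_gt (t / δ)
  have hm0 : (0 : ℝ) < m := (div_nonneg ht hδ.le).trans_lt hm
  have h1 : P (t / m) := h _ ⟨by positivity, by
    rw [div_lt_iff₀ hm0]; rwa [div_lt_iff₀ hδ, mul_comm] at hm⟩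
  have h2 : ∀ k : ℕ, P (k * (t / m)) := fun k ↦ by
    induction k with
    | zero => simpa using h 0 ⟨le_rfl, hδ⟩
    | succ k ih =>
      have := hadd _ _ ih h1
      rwa [show (k : ℝ) * (t / m) + t / m = (k + 1 : ℕ) * (t / m) by push_cast; ring] at this
  have h3 := h2 m
  rwa [mul_div_cancel₀ _ hm0.ne'] at h3

variable [T2Space N] [IsManifold (𝓡 n) ∞ N]

theorem flow_eq_of_isMIntegralCurve
    (hX : ContMDiff (𝓡 n) (𝓡 n).tangent ∞ (fun x => (⟨x, X x⟩ : TangentBundle (𝓡 n) N)))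
    {γ : ℝ → N} (hγ : IsMIntegralCurve (I := 𝓡 n) γ X) (t : ℝ) : flow X t (γ 0) = γ t := by
  have hex : ∃ γ' : ℝ → N, γ' 0 = γ 0 ∧ IsMIntegralCurve (I := 𝓡 n) γ' X := ⟨γ, rfl, hγ⟩
  have h : flow X t (γ 0) = hex.choose t := dif_pos hex
  rw [h, eq_of_isMIntegralCurve hX hex.choose_spec.2 hγ hex.choose_spec.1]

theorem flow_eq_self_of_eq_zero
    (hX : ContMDiff (𝓡 n) (𝓡 n).tangent ∞ (fun x => (⟨x, X x⟩ : TangentBundle (𝓡 n) N)))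
    {x : N} (hx : X x = 0) (t : ℝ) : flow X t x = x :=
  flow_eq_of_isMIntegralCurve hX (isMIntegralCurve_const hx) t

theorem flow_add
    (hX : ContMDiff (𝓡 n) (𝓡 n).tangent ∞ (fun x => (⟨x, X x⟩ : TangentBundle (𝓡 n) N)))
    (hex : ∀ x, ∃ γ : ℝ → N, γ 0 = x ∧ IsMIntegralCurve (I := 𝓡 n) γ X) (s t : ℝ) (x : N) :
    flow X (s + t) x = flow X s (flow X t x) := by
  have h := flow_eq_of_isMIntegralCurve hX ((flow_spec hex x).2.comp_add t) s
  simp only [Function.comp_apply, zero_add] at h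
  exact h.symm

theorem flow_eq_of_isMIntegralCurveOn
    (hX : ContMDiff (𝓡 n) (𝓡 n).tangent ∞ (fun x => (⟨x, X x⟩ : TangentBundle (𝓡 n) N)))
    (hex : ∀ x, ∃ γ : ℝ → N, γ 0 = x ∧ IsMIntegralCurve (I := 𝓡 n) γ X) {γ : ℝ → N} {ε : ℝ}
    (hε : 0 < ε) (hγ : IsMIntegralCurveOn (I := 𝓡 n) γ X (Ioo (-ε) ε)) {t : ℝ}
    (ht : t ∈ Ioo (-ε) ε) : flow X t (γ 0) = γ t := by
  have : IsManifold (𝓡 n) 1 N := IsManifold.of_le (n := ∞) (by simp)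
  exact isMIntegralCurveOn_Ioo_eqOn_of_contMDiff_boundaryless (t₀ := 0) ⟨by linarith, hε⟩
    (hX.of_le (by simp)) ((flow_spec hex (γ 0)).2.isMIntegralCurveOn _) hγ
    (flow_spec hex (γ 0)).1 ht

theorem flow_eventuallyEq_id
    (hX : ContMDiff (𝓡 n) (𝓡 n).tangent ∞ (fun x => (⟨x, X x⟩ : TangentBundle (𝓡 n) N)))
    (hK : IsCompact K) (hsupp : closure {x | X x ≠ 0} ⊆ K) {x : N} (hx : x ∉ K) (t : ℝ) :
    flow X t =ᶠ[𝓝 x] id := by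
  filter_upwards [hK.isClosed.isOpen_compl.mem_nhds hx] with y hy
  exact flow_eq_self_of_eq_zero hX (eq_zero_of_notMem hsupp hy) t

/-- On `K` the local flows are continuous in the initial point for a uniform short time, off `K` the
flow is locally the identity, and the group law reaches all times. -/
theorem continuous_flow
    (hX : ContMDiff (𝓡 n) (𝓡 n).tangent ∞ (fun x => (⟨x, X x⟩ : TangentBundle (𝓡 n) N)))
    (hK : IsCompact K) (hsupp : closure {x | X x ≠ 0} ⊆ K) (t : ℝ) : Continuous (flow X t) := by
  have hex := exists_isMIntegralCurve_of_support_subset hX hK hsupp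
  obtain ⟨δ, hδ, h⟩ := hK.exists_pos_forall_of_antitone
    (P := fun δ x ↦ ∀ t ∈ Ioo (-δ) δ, ContinuousAt (flow X t) x)
    (fun x δ δ' hδ h t ht ↦ h t ⟨by linarith [ht.1], ht.2.trans_le hδ⟩)
    (fun p ↦ by
      obtain ⟨U, hU, hp, ε, hε, β, hβ, hcont, -⟩ := exists_local_flow_of_mlieBracket_eq_zero hX hX
        (fun x ↦ by rw [VectorField.mlieBracket_self]; rfl) p
      refine ⟨ε, hε, ?_⟩
      filter_upwards [hU.mem_nhds hp] with x hx t ht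
      refine ((hcont t ht).continuousAt (hU.mem_nhds hx)).congr ?_
      filter_upwards [hU.mem_nhds hx] with y hy
      have := flow_eq_of_isMIntegralCurveOn hX hex hε (hβ y hy).2 ht
      rw [(hβ y hy).1] at this
      exact this.symm)
  have h' : ∀ t ∈ Ioo (-δ) δ, Continuous (flow X t) := fun t ht ↦
    continuous_iff_continuousAt.2 fun x ↦ by
      by_cases hx : x ∈ K
      · exact h x hx t ht
      · exact continuousAt_id.congr (flow_eventuallyEq_id hX hK hsupp hx t).symm
  -- Both signs are carried along because the extension from short times covers nonnegative times
  -- only.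
  have hP : ∀ t, 0 ≤ t → Continuous (flow X t) ∧ Continuous (flow X (-t)) := fun t ht ↦ by
    refine of_add_of_Ico (P := fun t ↦ Continuous (flow X t) ∧ Continuous (flow X (-t)))
      (fun s t hs ht ↦ ⟨?_, ?_⟩) hδ (fun t ht ↦ ⟨h' t ⟨by linarith [ht.1], ht.2⟩,
        h' (-t) ⟨by linarith [ht.2], by linarith [ht.1]⟩⟩) ht
    · rw [funext (flow_add hX hex s t)]
      exact hs.1.comp ht.1
    · rw [neg_add, funext (flow_add hX hex (-s) (-t))]
      exact hs.2.comp ht.2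
  rcases le_total 0 t with ht | ht
  · exact (hP t ht).1
  · simpa using (hP (-t) (by linarith)).2

/-- Quantifying over all curves tangent to `Y` makes the property stable under composing flows, so
the short-time statement iterates. -/
theorem isTangentAt_flow_comp
    (hX : ContMDiff (𝓡 n) (𝓡 n).tangent ∞ (fun x => (⟨x, X x⟩ : TangentBundle (𝓡 n) N)))
    (hY : ContMDiff (𝓡 n) (𝓡 n).tangent ∞ (fun x => (⟨x, Y x⟩ : TangentBundle (𝓡 n) N)))
    (hXY : ∀ x, VectorField.mlieBracket (𝓡 n) X Y x = 0)
    (hK : IsCompact K) (hsupp : closure {x | X x ≠ 0} ⊆ K) {t : ℝ} (ht : 0 ≤ t) {c : ℝ → N}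
    (hc : IsTangentAt Y c 0) : IsTangentAt Y (flow X t ∘ c) 0 := by
  have hex := exists_isMIntegralCurve_of_support_subset hX hK hsupp
  obtain ⟨δ, hδ, h⟩ := hK.exists_pos_forall_of_antitone
    (P := fun δ x ↦ ∀ t ∈ Ico 0 δ, ∀ c : ℝ → N, c 0 = x → IsTangentAt Y c 0 →
      IsTangentAt Y (flow X t ∘ c) 0)
    (fun x δ δ' hδ h t ht ↦ h t ⟨ht.1, ht.2.trans_le hδ⟩)
    (fun p ↦ by
      obtain ⟨U, hU, hp, ε, hε, β, hβ, -, htan⟩ :=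
        exists_local_flow_of_mlieBracket_eq_zero hX hY hXY p
      refine ⟨ε, hε, ?_⟩
      filter_upwards [hU.mem_nhds hp] with x hx t ht c hcx hc
      refine (htan t ht c (hcx ▸ hx) hc).congr ?_
      filter_upwards [(HasMFDerivAt.continuousAt hc).preimage_mem_nhds
        (hU.mem_nhds (hcx ▸ hx))] with s hs
      have := flow_eq_of_isMIntegralCurveOn hX hex hε (hβ _ hs).2 ⟨by linarith [ht.1], ht.2⟩
      rwa [(hβ _ hs).1] at this)
  refine of_add_of_Ico (P := fun t ↦ ∀ c : ℝ → N, IsTangentAt Y c 0 →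
    IsTangentAt Y (flow X t ∘ c) 0) (fun s t hs ht c hc ↦ ?_) hδ (fun t ht c hc ↦ ?_) ht c hc
  · rw [funext (flow_add hX hex s t)]
    exact hs _ (ht c hc)
  · by_cases hx : c 0 ∈ K
    · exact h _ hx t ht c rfl hc
    · refine hc.congr ?_
      exact (HasMFDerivAt.continuousAt hc).eventually (flow_eventuallyEq_id hX hK hsupp hx t)

/-- For `s ≥ 0`, pushing a `Y`-trajectory forward by the flow of `X` gives an integral curve of `Y`,
which uniqueness identifies. Negative `s` follows by inverting the flow. -/
theorem flow_comm
    (hX : ContMDiff (𝓡 n) (𝓡 n).tangent ∞ (fun x => (⟨x, X x⟩ : TangentBundle (𝓡 n) N)))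
    (hY : ContMDiff (𝓡 n) (𝓡 n).tangent ∞ (fun x => (⟨x, Y x⟩ : TangentBundle (𝓡 n) N)))
    (hXY : ∀ x, VectorField.mlieBracket (𝓡 n) X Y x = 0)
    (hK : IsCompact K) (hsX : closure {x | X x ≠ 0} ⊆ K) (hsY : closure {x | Y x ≠ 0} ⊆ K)
    (s t : ℝ) (x : N) : flow X s (flow Y t x) = flow Y t (flow X s x) := by
  have hexX := exists_isMIntegralCurve_of_support_subset hX hK hsX
  have hexY := exists_isMIntegralCurve_of_support_subset hY hK hsY
  have key : ∀ s, 0 ≤ s → ∀ x, flow X s (flow Y t x) = flow Y t (flow X s x) := fun s hs x ↦ by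
    have hcurve : IsMIntegralCurve (I := 𝓡 n) (fun t ↦ flow X s (flow Y t x)) Y := fun t₀ ↦ by
      have h1 : IsTangentAt Y (fun t ↦ flow Y (t + t₀) x) 0 :=
        (flow_spec hexY x).2.comp_add t₀ 0
      have h2 := isTangentAt_flow_comp hX hY hXY hK hsX hs h1
      have h3 : IsTangentAt Y (fun t ↦ flow X s (flow Y t x)) t₀ := by
        simpa only [Function.comp_def, sub_add_cancel] using h2.comp_sub t₀
      exact h3
    have h := flow_eq_of_isMIntegralCurve hY hcurve t
    rw [(flow_spec hexY x).1] at h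
    exact h.symm
  rcases le_total 0 s with hs | hs
  · exact key s hs x
  · have h := key (-s) (by linarith) (flow X s x)
    have h2 : ∀ y, flow X s (flow X (-s) y) = y := fun y ↦ by
      rw [← flow_add hX hexX, add_neg_cancel, (flow_spec hexX y).1]
    have h3 : ∀ y, flow X (-s) (flow X s y) = y := fun y ↦ by
      rw [← flow_add hX hexX, neg_add_cancel, (flow_spec hexX y).1]
    rw [h3] at h
    rw [← h, h2]

end Flow

/-- Applied in `Function.End N`, whose product is composition, this gives the additivity of the
joint flow. -/
theorem _root_.List.prod_ofFn_mul_of_commute {M : Type*} [Monoid M] :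
    ∀ {d : ℕ} (f g : Fin d → M), (∀ i j, Commute (f i) (g j)) →
      (List.ofFn fun i ↦ f i * g i).prod = (List.ofFn f).prod * (List.ofFn g).prod
  | 0, _, _, _ => by simp
  | d + 1, f, g, h => by
    have hc : Commute (List.ofFn fun i : Fin d ↦ f i.succ).prod (g 0) :=
      Commute.list_prod_left _ _ fun x hx ↦ by
        obtain ⟨i, rfl⟩ := List.mem_ofFn.1 hx
        exact h _ _
    simp only [List.ofFn_succ, List.prod_cons]
    rw [List.prod_ofFn_mul_of_commute _ _ fun i j ↦ h i.succ j.succ, mul_assoc, mul_assoc,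
      ← mul_assoc (g 0), ← hc.eq, mul_assoc]

/-! ### The joint flow and derivative bounds for smooth vectors. -/

section Action

variable {n d : ℕ} {N : Type*} [TopologicalSpace N]
  [ChartedSpace (EuclideanSpace ℝ (Fin n)) N]
  {X : Fin d → (x : N) → TangentSpace (𝓡 n) x}

theorem jointFlow_add (hadd : ∀ i s t, flow (X i) (s + t) = flow (X i) s ∘ flow (X i) t)
    (hcomm : ∀ i j s t, flow (X i) s ∘ flow (X j) t = flow (X j) t ∘ flow (X i) s) (v w : V d) :
    jointFlow X (v + w) = jointFlow X v ∘ jointFlow X w := by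
  have h := List.prod_ofFn_mul_of_commute (M := Function.End N) (fun i ↦ flow (X i) (v i))
    (fun i ↦ flow (X i) (w i)) fun i j ↦ hcomm i j _ _
  have h2 : (fun i ↦ flow (X i) ((v + w) i)) =
      fun i ↦ flow (X i) (v i) ∘ flow (X i) (w i) :=
    funext fun i ↦ hadd i _ _
  unfold jointFlow
  rw [h2]
  exact h

theorem List.foldr_comp_induction {α : Type*} {P : (α → α) → Prop} (hid : P id)
    (hcomp : ∀ f g, P f → P g → P (f ∘ g)) :
    ∀ l : List (α → α), (∀ f ∈ l, P f) → P (l.foldr (· ∘ ·) id)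
  | [], _ => hid
  | f :: l, h => hcomp f _ (h f (by simp))
      (List.foldr_comp_induction hid hcomp l fun g hg ↦ h g (by simp [hg]))

theorem jointFlow_induction {P : (N → N) → Prop} (hid : P id)
    (hcomp : ∀ f g, P f → P g → P (f ∘ g)) (h : ∀ i t, P (flow (X i) t)) (v : V d) :
    P (jointFlow X v) :=
  List.foldr_comp_induction hid hcomp _ fun f hf ↦ by
    obtain ⟨i, rfl⟩ := List.mem_ofFn.1 hf
    exact h _ _

/-- Composition with a continuous map as a continuous linear map on bounded functions. -/
noncomputable def compContinuousCLM {α : Type*} [TopologicalSpace α] (g : C(α, α)) :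
    (α →ᵇ ℂ) →L[ℝ] (α →ᵇ ℂ) :=
  LinearMap.mkContinuous
    { toFun := fun f ↦ f.compContinuous g
      map_add' := fun _ _ ↦ rfl
      map_smul' := fun _ _ ↦ rfl } 1 fun f ↦ by
    rw [one_mul]
    exact f.norm_compContinuous_le g

/-- By the group law, translating the orbit map by `v` amounts to composing it with the linear map
`h ↦ h ∘ jointFlow X v`, whose norm is at most `1`. -/
theorem norm_iteratedFDeriv_action_le (hcont : ∀ v : V d, Continuous (jointFlow X v))
    (hadd : ∀ v w : V d, jointFlow X (v + w) = jointFlow X v ∘ jointFlow X w) {f : N →ᵇ ℂ}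
    (hf : f ∈ smoothVectors X) (k : ℕ) (v : V d) :
    ‖iteratedFDeriv ℝ k (fun v : V d ↦ action X v f) v‖ ≤
      ‖iteratedFDeriv ℝ k (fun v : V d ↦ action X v f) 0‖ := by
  have haction : ∀ (v : V d) (f : N →ᵇ ℂ), action X v f = f.compContinuous ⟨_, hcont v⟩ :=
    fun v f ↦ dif_pos (hcont v)
  have h1 : (fun w : V d ↦ action X (w + v) f) =
      compContinuousCLM ⟨_, hcont v⟩ ∘ fun w ↦ action X w f := by
    funext w
    ext x
    simp only [haction, hadd, BoundedContinuousFunction.compContinuous_apply, Function.comp_apply,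
      ContinuousMap.coe_mk]
    rfl
  have h2 := iteratedFDeriv_comp_add_right (𝕜 := ℝ) (f := fun v : V d ↦ action X v f) k v 0
  rw [zero_add, h1] at h2
  rw [← h2]
  have hf' : ContDiff ℝ ∞ (fun v : V d ↦ action X v f) := hf
  rw [ContinuousLinearMap.iteratedFDeriv_comp_left _ hf'.contDiffAt (by exact_mod_cast le_top)]
  refine (ContinuousLinearMap.norm_compContinuousMultilinearMap_le _ _).trans ?_
  exact mul_le_of_le_one_left (norm_nonneg _) (LinearMap.mkContinuous_norm_le _ zero_le_one _)

end Action

end Flows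

section OscillatoryIntegrals

open Set Filter Topology MeasureTheory

/-! ### Families of symbols with uniform derivative bounds. -/

section SymbolFamily

variable {ι κ E F A B : Type*} [NormedAddCommGroup E] [NormedSpace ℝ E]
  [NormedAddCommGroup F] [NormedSpace ℝ F] [NormedAddCommGroup A] [NormedSpace ℝ A]
  [NormedAddCommGroup B] [NormedSpace ℝ B] {G H : ι → E → A} {ρ ρ' : E → ℝ}

/-- A family of smooth functions each of whose derivatives is bounded by a multiple of `ρ`,
uniformly in the family. -/
structure IsSymbolFamily (ρ : E → ℝ) (G : ι → E → A) : Prop where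
  contDiff : ∀ i, ContDiff ℝ ∞ (G i)
  bound : ∀ k : ℕ, ∃ C : ℝ, 0 ≤ C ∧ ∀ i z, ‖iteratedFDeriv ℝ k (G i) z‖ ≤ C * ρ z

namespace IsSymbolFamily

theorem congr_index (hG : IsSymbolFamily ρ G) (σ : κ → ι) : IsSymbolFamily ρ (fun j ↦ G (σ j)) where
  contDiff _ := hG.contDiff _
  bound k := (hG.bound k).imp fun _ h ↦ ⟨h.1, fun _ z ↦ h.2 _ z⟩

theorem bilinear (hρ : ∀ z, 0 ≤ ρ z) {K : ι → E → F} (hG : IsSymbolFamily ρ G)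
    (hK : IsSymbolFamily ρ' K) (L : A →L[ℝ] F →L[ℝ] B) :
    IsSymbolFamily (fun z ↦ ρ z * ρ' z) (fun i z ↦ L (G i z) (K i z)) where
  contDiff i := L.isBoundedBilinearMap.contDiff.comp ((hG.contDiff i).prodMk (hK.contDiff i))
  bound k := by
    choose C hC hCG using hG.bound
    choose D hD hDK using hK.bound
    refine ⟨‖L‖ * ∑ i ∈ Finset.range (k + 1), (k.choose i) * C i * D (k - i),
      mul_nonneg (norm_nonneg L) (Finset.sum_nonneg fun i _ ↦
        mul_nonneg (mul_nonneg (Nat.cast_nonneg _) (hC i)) (hD _)), fun i z ↦ ?_⟩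
    refine (L.norm_iteratedFDeriv_le_of_bilinear (hG.contDiff i) (hK.contDiff i) z
      (by exact_mod_cast le_top)).trans ?_
    rw [mul_assoc, Finset.sum_mul]
    refine mul_le_mul_of_nonneg_left (Finset.sum_le_sum fun j _ ↦ ?_) (norm_nonneg L)
    calc _ ≤ (k.choose j) * (C j * ρ z) * (D (k - j) * ρ' z) :=
          mul_le_mul (mul_le_mul_of_nonneg_left (hCG _ _ _) (Nat.cast_nonneg _)) (hDK _ _ _)
            (norm_nonneg _) (mul_nonneg (Nat.cast_nonneg _) (mul_nonneg (hC j) (hρ z)))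
      _ = _ := by ring

theorem sub (hG : IsSymbolFamily ρ G) (hH : IsSymbolFamily ρ H) :
    IsSymbolFamily ρ (fun i z ↦ G i z - H i z) where
  contDiff i := (hG.contDiff i).sub (hH.contDiff i)
  bound k := by
    obtain ⟨C, hC, hCG⟩ := hG.bound k
    obtain ⟨D, hD, hDH⟩ := hH.bound k
    refine ⟨C + D, add_nonneg hC hD, fun i z ↦ ?_⟩
    have h := iteratedFDeriv_sub_apply (x := z) ((hG.contDiff i).contDiffAt.of_le
      (by exact_mod_cast le_top : (k : WithTop ℕ∞) ≤ ∞)) ((hH.contDiff i).contDiffAt.of_le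
      (by exact_mod_cast le_top : (k : WithTop ℕ∞) ≤ ∞))
    calc ‖iteratedFDeriv ℝ k (fun z ↦ G i z - H i z) z‖ = _ := congrArg norm h
      _ ≤ _ := norm_sub_le _ _
      _ ≤ C * ρ z + D * ρ z := add_le_add (hCG i z) (hDH i z)
      _ = _ := by ring

theorem clm_comp (hG : IsSymbolFamily ρ G) (L : A →L[ℝ] B) :
    IsSymbolFamily ρ (fun i z ↦ L (G i z)) where
  contDiff i := L.contDiff.comp (hG.contDiff i)
  bound k := by
    obtain ⟨C, hC, hCG⟩ := hG.bound k
    refine ⟨‖L‖ * C, mul_nonneg (norm_nonneg _) hC, fun i z ↦ ?_⟩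
    refine (L.norm_iteratedFDeriv_comp_left (hG.contDiff i).contDiffAt
      (by exact_mod_cast le_top : (k : WithTop ℕ∞) ≤ ∞)).trans ?_
    rw [mul_assoc]
    exact mul_le_mul_of_nonneg_left (hCG i z) (norm_nonneg _)

theorem fderiv_apply (hG : IsSymbolFamily ρ G) (a : E) :
    IsSymbolFamily ρ (fun i z ↦ fderiv ℝ (G i) z a) := by
  have h : IsSymbolFamily ρ (fun i ↦ fderiv ℝ (G i)) :=
    ⟨fun i ↦ (hG.contDiff i).fderiv_right (by simp), fun k ↦ by
      obtain ⟨C, hC, hCG⟩ := hG.bound (k + 1)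
      exact ⟨C, hC, fun i z ↦ norm_iteratedFDeriv_fderiv.trans_le (hCG i z)⟩⟩
  exact h.clm_comp (ContinuousLinearMap.apply ℝ A a)

theorem comp_clm (hG : IsSymbolFamily ρ G) (hρ : ∀ z, 0 ≤ ρ z) {L : ι → F →L[ℝ] E} {M : ℝ}
    (hL : ∀ i, ‖L i‖ ≤ M) {τ : F → ℝ} (hτ : ∀ i z, ρ (L i z) ≤ τ z) :
    IsSymbolFamily τ (fun i z ↦ G i (L i z)) where
  contDiff i := (hG.contDiff i).comp (L i).contDiff
  bound k := by
    obtain ⟨C, hC, hCG⟩ := hG.bound k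
    refine ⟨C * |M| ^ k, by positivity, fun i z ↦ ?_⟩
    have h := (L i).iteratedFDeriv_comp_right (hG.contDiff i) z
      (by exact_mod_cast le_top : (k : WithTop ℕ∞) ≤ ∞)
    calc ‖iteratedFDeriv ℝ k (fun z ↦ G i (L i z)) z‖ = _ := congrArg norm h
      _ ≤ ‖iteratedFDeriv ℝ k (G i) (L i z)‖ * ∏ _j : Fin k, ‖L i‖ :=
        ContinuousMultilinearMap.norm_compContinuousLinearMap_le _ _
      _ ≤ (C * ρ (L i z)) * |M| ^ k := by
        rw [Finset.prod_const, Finset.card_univ, Fintype.card_fin]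
        exact mul_le_mul (hCG i _) (pow_le_pow_left₀ (norm_nonneg _)
          ((hL i).trans (le_abs_self M)) k) (by positivity) (mul_nonneg hC (hρ _))
      _ ≤ C * τ z * |M| ^ k := by gcongr; exact hτ i z
      _ = _ := by ring

theorem norm_le (hG : IsSymbolFamily ρ G) : ∃ C : ℝ, ∀ i z, ‖G i z‖ ≤ C * ρ z := by
  obtain ⟨C, -, hC⟩ := hG.bound 0
  exact ⟨C, fun i z ↦ by simpa using hC i z⟩

end IsSymbolFamily

theorem isSymbolFamily_of_hasCompactSupport {f : E → A} (hf : ContDiff ℝ ∞ f)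
    (hc : HasCompactSupport f) : IsSymbolFamily (fun _ ↦ 1) (fun _ : Unit ↦ f) where
  contDiff _ := hf
  bound k := by
    obtain ⟨C, hC⟩ := (hf.continuous_iteratedFDeriv
      (by exact_mod_cast le_top : (k : WithTop ℕ∞) ≤ ∞)).bounded_above_of_compact_support
      (hc.iteratedFDeriv k)
    exact ⟨|C|, abs_nonneg C, fun _ z ↦ by simpa using (hC z).trans (le_abs_self C)⟩

end SymbolFamily

/-! ### Resolvent factors and regularization by integration by parts. -/

section Resolvent

variable {E : Type*} [NormedAddCommGroup E] [NormedSpace ℝ E]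

theorem one_add_ofReal_mul_I_ne_zero (x : ℝ) : (1 + x * Complex.I : ℂ) ≠ 0 := fun h ↦ by
  simpa using congrArg Complex.re h

theorem iteratedDeriv_inv_one_add_mul_I (k : ℕ) :
    iteratedDeriv k (fun x : ℝ ↦ (1 + x * Complex.I : ℂ)⁻¹) =
      fun x : ℝ ↦ ((-Complex.I) ^ k * k.factorial) * ((1 + x * Complex.I : ℂ)⁻¹) ^ (k + 1) := by
  induction k with
  | zero => simp
  | succ k ih =>
    rw [iteratedDeriv_succ, ih]
    funext x
    have h1 : HasDerivAt (fun x : ℝ ↦ (1 + x * Complex.I : ℂ)) Complex.I x := by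
      simpa using ((Complex.ofRealCLM.hasDerivAt (x := x)).mul_const Complex.I).const_add 1
    have h2 := (((h1.inv (one_add_ofReal_mul_I_ne_zero x)).pow (k + 1)).const_mul
      ((-Complex.I) ^ k * k.factorial)).deriv
    refine Eq.trans h2 ?_
    simp only [Nat.factorial_succ, Nat.cast_mul, Nat.add_sub_cancel, Pi.inv_apply]
    rw [div_eq_mul_inv, ← inv_pow]
    generalize (1 + x * Complex.I : ℂ)⁻¹ = r
    push_cast
    ring

/-- The function `1 / (1 + i ℓ)`. -/
noncomputable def resolvent (ℓ : E →L[ℝ] ℝ) (z : E) : ℂ := (1 + ℓ z * Complex.I)⁻¹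

theorem norm_inv_one_add_mul_I_sq (x : ℝ) :
    ‖(1 + x * Complex.I : ℂ)⁻¹‖ ^ 2 = (1 + x ^ 2)⁻¹ := by
  rw [norm_inv, inv_pow, ← Complex.normSq_eq_norm_sq, Complex.normSq_apply]
  simp [pow_two]

theorem norm_inv_one_add_mul_I_le (x : ℝ) : ‖(1 + x * Complex.I : ℂ)⁻¹‖ ≤ 1 := by
  have h := norm_inv_one_add_mul_I_sq x
  have h1 : (1 + x ^ 2)⁻¹ ≤ 1 := inv_le_one_of_one_le₀ (by nlinarith [sq_nonneg x])
  rw [← h] at h1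
  exact (pow_le_one_iff_of_nonneg (norm_nonneg _) two_ne_zero).1 h1

/-- The `k`-th derivative of `r = 1 / (1 + ix)` has modulus `k! |r|^(k+1) ≤ k! |r|`, so
differentiating never loses the decay of `r`. -/
theorem isSymbolFamily_resolvent (ι : Type*) (ℓ : E →L[ℝ] ℝ) :
    IsSymbolFamily (fun z ↦ ‖resolvent ℓ z‖) (fun _ : ι ↦ resolvent ℓ) := by
  have h : IsSymbolFamily (fun x : ℝ ↦ ‖(1 + x * Complex.I : ℂ)⁻¹‖)
      (fun _ : ι ↦ fun x : ℝ ↦ (1 + x * Complex.I : ℂ)⁻¹) := by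
    refine ⟨fun _ ↦ ?_, fun k ↦ ⟨k.factorial, by positivity, fun _ x ↦ ?_⟩⟩
    · exact (contDiff_const.add (Complex.ofRealCLM.contDiff.mul contDiff_const)).inv
        one_add_ofReal_mul_I_ne_zero
    · rw [norm_iteratedFDeriv_eq_norm_iteratedDeriv, iteratedDeriv_inv_one_add_mul_I]
      simp only [norm_mul, norm_pow, norm_neg, Complex.norm_I, one_pow, one_mul,
        Complex.norm_natCast]
      gcongr
      exact pow_le_of_le_one (norm_nonneg _) (norm_inv_one_add_mul_I_le x) (by simp)
  exact h.comp_clm (L := fun _ ↦ ℓ) (fun _ ↦ norm_nonneg _) (fun _ ↦ le_rfl) fun _ _ ↦ le_rfl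

end Resolvent

section Regularization

variable {ι E A : Type*} [NormedAddCommGroup E] [NormedSpace ℝ E]
  [NormedAddCommGroup A] [NormedSpace ℂ A]

/-- The transpose of `e ↦ (1 + i ℓ)⁻¹ (e + ∂_a e / 2π)`, an operator that leaves `e` unchanged if
`∂_a e = 2 π i ℓ e`. -/
noncomputable def regularize (p : E × (E →L[ℝ] ℝ)) (G : E → A) (z : E) : A :=
  resolvent p.2 z • G z -
    ((2 * Real.pi)⁻¹ : ℝ) • fderiv ℝ (fun y ↦ resolvent p.2 y • G y) z p.1

/-- The composition of the operators `regularize p` for `p` in a list. -/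
noncomputable def regularizeList (l : List (E × (E →L[ℝ] ℝ))) (G : E → A) : E → A :=
  l.foldr regularize G

/-- The decay gained by `regularizeList`. -/
noncomputable def regularizeWeight (l : List (E × (E →L[ℝ] ℝ))) (z : E) : ℝ :=
  (l.map fun p ↦ ‖resolvent p.2 z‖).prod

/-- Multiplying by the resolvent gains its modulus as a weight, and the directional derivative
preserves that weight. -/
theorem IsSymbolFamily.regularize {ρ : E → ℝ} {G : ι → E → A}
    (hG : IsSymbolFamily ρ G) (p : E × (E →L[ℝ] ℝ)) :
    IsSymbolFamily (fun z ↦ ‖resolvent p.2 z‖ * ρ z) (fun i ↦ regularize p (G i)) := by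
  have h1 := (isSymbolFamily_resolvent ι p.2).bilinear (fun _ ↦ norm_nonneg _) hG
    (ContinuousLinearMap.lsmul ℝ ℂ : ℂ →L[ℝ] A →L[ℝ] A)
  exact h1.sub ((h1.fderiv_apply p.1).clm_comp
    (((2 * Real.pi)⁻¹ : ℝ) • ContinuousLinearMap.id ℝ A))

theorem IsSymbolFamily.regularizeList {ρ : E → ℝ} {G : ι → E → A}
    (hG : IsSymbolFamily ρ G) (l : List (E × (E →L[ℝ] ℝ))) :
    IsSymbolFamily (fun z ↦ regularizeWeight l z * ρ z) (fun i ↦ regularizeList l (G i)) := by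
  induction l with
  | nil =>
    simpa only [regularizeWeight, List.map_nil, List.prod_nil, one_mul] using! hG
  | cons p l ih =>
    have := ih.regularize p
    simpa only [regularizeWeight, List.map_cons, List.prod_cons, mul_assoc] using! this

theorem contDiff_resolvent (ℓ : E →L[ℝ] ℝ) : ContDiff ℝ ∞ (resolvent ℓ) :=
  (isSymbolFamily_resolvent Unit ℓ).contDiff ()

theorem contDiff_regularize {G : E → A} (hG : ContDiff ℝ ∞ G) (p : E × (E →L[ℝ] ℝ)) :
    ContDiff ℝ ∞ (regularize p G) := by
  have h1 : ContDiff ℝ ∞ fun y ↦ resolvent p.2 y • G y := (contDiff_resolvent p.2).smul hG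
  exact h1.sub (((h1.fderiv_right (by simp)).clm_apply contDiff_const).const_smul _)

theorem contDiff_regularizeList {G : E → A} (hG : ContDiff ℝ ∞ G)
    (l : List (E × (E →L[ℝ] ℝ))) : ContDiff ℝ ∞ (regularizeList l G) := by
  induction l with
  | nil => exact hG
  | cons p l ih => exact contDiff_regularize ih p

theorem hasCompactSupport_regularize {G : E → A} (hG : HasCompactSupport G)
    (p : E × (E →L[ℝ] ℝ)) : HasCompactSupport (regularize p G) := by
  have h1 : HasCompactSupport fun y ↦ resolvent p.2 y • G y := hG.smul_left
  have h2 := h1.fderiv_apply (𝕜 := ℝ) p.1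
  exact h1.sub (h2.smul_left (f := fun _ ↦ ((2 * Real.pi)⁻¹ : ℝ)))

theorem hasCompactSupport_regularizeList {G : E → A} (hG : HasCompactSupport G)
    (l : List (E × (E →L[ℝ] ℝ))) : HasCompactSupport (regularizeList l G) := by
  induction l with
  | nil => exact hG
  | cons p l ih => exact hasCompactSupport_regularize ih p

/-- Regularization is a differential operator, hence local. -/
theorem regularizeList_congr {G H : E → A} {z : E} (h : G =ᶠ[𝓝 z] H)
    (l : List (E × (E →L[ℝ] ℝ))) : regularizeList l G =ᶠ[𝓝 z] regularizeList l H := by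
  induction l with
  | nil => exact h
  | cons p l ih =>
    have h1 : (fun y ↦ resolvent p.2 y • regularizeList l G y) =ᶠ[𝓝 z]
        fun y ↦ resolvent p.2 y • regularizeList l H y := by
      filter_upwards [ih] with y hy
      rw [hy]
    filter_upwards [h1, h1.fderiv (𝕜 := ℝ)] with y hy hy'
    simp only [regularizeList, List.foldr_cons, regularize] at hy hy' ⊢
    rw [hy, hy']

variable [FiniteDimensional ℝ E] [MeasurableSpace E] [BorelSpace E] (μ : Measure E)
  [μ.IsAddHaarMeasure]

theorem integral_smul_regularize {e : E → ℂ} (he : ContDiff ℝ ∞ e) {p : E × (E →L[ℝ] ℝ)}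
    (hp : ∀ z, fderiv ℝ e z p.1 = 2 * Real.pi * Complex.I * p.2 z * e z) {G : E → A}
    (hG : ContDiff ℝ ∞ G) (hc : HasCompactSupport G) :
    ∫ z, e z • regularize p G z ∂μ = ∫ z, e z • G z ∂μ := by
  obtain ⟨H, hH⟩ : ∃ H : E → A, H = fun y ↦ resolvent p.2 y • G y := ⟨_, rfl⟩
  have hHs : ContDiff ℝ ∞ H := hH ▸ (contDiff_resolvent p.2).smul hG
  have hHc : HasCompactSupport H := hH ▸ hc.smul_left
  have hdH : Continuous fun z ↦ fderiv ℝ H z p.1 :=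
    (hHs.continuous_fderiv (by simp)).clm_apply continuous_const
  have hde : Continuous fun z ↦ fderiv ℝ e z p.1 :=
    (he.continuous_fderiv (by simp)).clm_apply continuous_const
  have i1 : Integrable (fun z ↦ e z • H z) μ :=
    (he.continuous.smul hHs.continuous).integrable_of_hasCompactSupport hHc.smul_left
  have i2 : Integrable (fun z ↦ e z • fderiv ℝ H z p.1) μ :=
    (he.continuous.smul hdH).integrable_of_hasCompactSupport
      (hHc.fderiv_apply (𝕜 := ℝ) p.1).smul_left
  have i3 : Integrable (fun z ↦ fderiv ℝ e z p.1 • H z) μ :=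
    (hde.smul hHs.continuous).integrable_of_hasCompactSupport hHc.smul_left
  have hibp := integral_smul_fderiv_eq_neg_fderiv_smul_of_integrable (𝕜 := ℂ) i3 i2 i1
    (fun z _ ↦ he.differentiable (by simp) z) (fun z _ ↦ hHs.differentiable (by simp) z)
  have i2' : Integrable (fun z ↦ ((2 * Real.pi)⁻¹ : ℝ) • (e z • fderiv ℝ H z p.1)) μ := i2.smul _
  have i3' : Integrable (fun z ↦ ((2 * Real.pi)⁻¹ : ℝ) • (fderiv ℝ e z p.1 • H z)) μ := i3.smul _
  -- As `∂_a e / 2π = iℓ e`, the right side is `(1 + iℓ) e H`, and `(1 + iℓ) H = G`.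
  have hpt : ∀ z, e z • G z = e z • H z + ((2 * Real.pi)⁻¹ : ℝ) • (fderiv ℝ e z p.1 • H z) := by
    intro z
    have h1 : G z = (1 + p.2 z * Complex.I : ℂ) • H z := by
      simp only [hH, resolvent, smul_smul]
      rw [mul_inv_cancel₀ (one_add_ofReal_mul_I_ne_zero _), one_smul]
    rw [h1, hp z, smul_smul, ← Complex.coe_smul, smul_smul, ← add_smul]
    congr 1
    have : (Real.pi : ℂ) ≠ 0 := by exact_mod_cast Real.pi_ne_zero
    push_cast
    field_simp
  calc ∫ z, e z • regularize p G z ∂μ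
      = ∫ z, (e z • H z - ((2 * Real.pi)⁻¹ : ℝ) • (e z • fderiv ℝ H z p.1)) ∂μ := by
        congr 1
        funext z
        rw [regularize, smul_sub, ← hH, hH, smul_comm _ ((2 * Real.pi)⁻¹ : ℝ)]
    _ = ∫ z, e z • H z ∂μ - ((2 * Real.pi)⁻¹ : ℝ) • ∫ z, e z • fderiv ℝ H z p.1 ∂μ := by
        rw [integral_sub i1 i2', integral_smul]
    _ = ∫ z, e z • H z ∂μ + ((2 * Real.pi)⁻¹ : ℝ) • ∫ z, fderiv ℝ e z p.1 • H z ∂μ := by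
        rw [hibp, smul_neg, sub_neg_eq_add]
    _ = ∫ z, e z • G z ∂μ := by
        rw [← integral_smul, ← integral_add i1 i3']
        simp only [hpt]

theorem integral_smul_regularizeList {e : E → ℂ} (he : ContDiff ℝ ∞ e)
    {l : List (E × (E →L[ℝ] ℝ))}
    (hl : ∀ p ∈ l, ∀ z, fderiv ℝ e z p.1 = 2 * Real.pi * Complex.I * p.2 z * e z) {G : E → A}
    (hG : ContDiff ℝ ∞ G) (hc : HasCompactSupport G) :
    ∫ z, e z • regularizeList l G z ∂μ = ∫ z, e z • G z ∂μ := by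
  induction l with
  | nil => rfl
  | cons p l ih =>
    rw [← ih fun p hp ↦ hl p (List.mem_cons_of_mem _ hp)]
    exact integral_smul_regularize μ he (hl p List.mem_cons_self) (contDiff_regularizeList hG l)
      (hasCompactSupport_regularizeList hc l)

/-- The oscillating integral as a limit over cutoffs that are bounded as symbols. -/
theorem tendsto_integral_cutoff {e : E → ℂ} (he : ContDiff ℝ ∞ e) (he1 : ∀ z, ‖e z‖ ≤ 1)
    {l : List (E × (E →L[ℝ] ℝ))}
    (hl : ∀ p ∈ l, ∀ z, fderiv ℝ e z p.1 = 2 * Real.pi * Complex.I * p.2 z * e z)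
    (hint : Integrable (regularizeWeight l) μ) {f : Filter ι} [f.IsCountablyGenerated]
    {Φ : ι → E → ℂ} (hΦ : IsSymbolFamily (fun _ ↦ 1) Φ) (hΦc : ∀ i, HasCompactSupport (Φ i))
    (hΦ1 : ∀ z, ∀ᶠ i in f, Φ i =ᶠ[𝓝 z] fun _ ↦ 1) {F : E → A}
    (hF : IsSymbolFamily (fun _ ↦ 1) (fun _ : Unit ↦ F)) :
    Tendsto (fun i ↦ ∫ z, (Φ i z * e z) • F z ∂μ) f (𝓝 (∫ z, e z • regularizeList l F z ∂μ)) := by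
  have hFs : ContDiff ℝ ∞ F := hF.contDiff ()
  have hfam : IsSymbolFamily (fun _ ↦ 1) (fun i z ↦ Φ i z • F z) := by
    simpa using! hΦ.bilinear (fun _ ↦ zero_le_one) (hF.congr_index fun _ : ι ↦ ())
      (ContinuousLinearMap.lsmul ℝ ℂ : ℂ →L[ℝ] A →L[ℝ] A)
  obtain ⟨C, hC⟩ := (hfam.regularizeList l).norm_le
  -- Integrating by parts before the limit is legitimate because the cutoffs have compact support;
  -- afterwards one integrable weight dominates all integrands.
  have heq : ∀ i, ∫ z, (Φ i z * e z) • F z ∂μ =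
      ∫ z, e z • regularizeList l (fun z ↦ Φ i z • F z) z ∂μ := fun i ↦ by
    rw [integral_smul_regularizeList μ he hl (hfam.contDiff i) (hΦc i).smul_right]
    simp only [smul_smul, mul_comm]
  simp only [heq]
  refine tendsto_integral_filter_of_dominated_convergence (fun z ↦ C * regularizeWeight l z)
    (Eventually.of_forall fun i ↦ ?_) (Eventually.of_forall fun i ↦ Eventually.of_forall fun z ↦ ?_)
    (hint.const_mul C) (Eventually.of_forall fun z ↦ ?_)
  · have hcont := he.continuous.smul (contDiff_regularizeList (hfam.contDiff i) l).continuous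
    exact (hcont.integrable_of_hasCompactSupport
      (hasCompactSupport_regularizeList (hΦc i).smul_right l).smul_left).aestronglyMeasurable
  · rw [norm_smul]
    exact (mul_le_of_le_one_left (norm_nonneg _) (he1 z)).trans (by simpa using hC i z)
  · refine tendsto_const_nhds.congr' ?_
    filter_upwards [hΦ1 z] with i hi
    have h1 : F =ᶠ[𝓝 z] fun y ↦ Φ i y • F y := by
      filter_upwards [hi] with y hy
      rw [hy, one_smul]
    rw [(regularizeList_congr h1 l).self_of_nhds]

end Regularization

/-! ### The phase and an integrable weight. -/

section Phase

variable {d : ℕ}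

/-- The oscillating factor `e^{2πi u⋅v}`. -/
noncomputable def phase (z : V d × V d) : ℂ :=
  Complex.exp (2 * Real.pi * Complex.I * ((inner ℝ z.1 z.2 : ℝ) : ℂ))

theorem norm_phase (z : V d × V d) : ‖phase z‖ = 1 := by
  have h : (2 * Real.pi * Complex.I * ((inner ℝ z.1 z.2 : ℝ) : ℂ)) =
      ((2 * Real.pi * inner ℝ z.1 z.2 : ℝ) : ℂ) * Complex.I := by push_cast; ring
  rw [phase, h, Complex.norm_exp_ofReal_mul_I]

theorem contDiff_phase : ContDiff ℝ ∞ (phase (d := d)) := by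
  have h : ContDiff ℝ ∞ fun z : V d × V d ↦ (inner ℝ z.1 z.2 : ℝ) :=
    contDiff_fst.inner ℝ contDiff_snd
  exact Complex.contDiff_exp.comp (contDiff_const.mul (Complex.ofRealCLM.contDiff.comp h))

theorem fderiv_phase (z a : V d × V d) : fderiv ℝ phase z a =
    2 * Real.pi * Complex.I * ((inner ℝ z.1 a.2 + inner ℝ a.1 z.2 : ℝ) : ℂ) * phase z := by
  have h1 : HasFDerivAt (fun z : V d × V d ↦ (inner ℝ z.1 z.2 : ℝ)) _ z :=
    (hasFDerivAt_fst (𝕜 := ℝ) (E := V d) (F := V d) (p := z)).inner ℝ hasFDerivAt_snd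
  have h2 := (((Complex.ofRealCLM.hasFDerivAt.comp z h1).const_mul
    (2 * Real.pi * Complex.I : ℂ)).cexp).fderiv
  refine (congrArg (fun L ↦ L a) h2).trans ?_
  simp [phase, fderivInnerCLM_apply]
  ring

/-- The directions and linear forms for which `∂_a e^{2πi u⋅v} = 2πi ℓ(u, v) e^{2πi u⋅v}` used to
regularize oscillating integrals: every coordinate occurs twice. -/
noncomputable def phaseList (d : ℕ) : List ((V d × V d) × ((V d × V d) →L[ℝ] ℝ)) :=
  let f : Fin d → (V d × V d) × ((V d × V d) →L[ℝ] ℝ) := fun j ↦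
    ((EuclideanSpace.single j 1, 0), (EuclideanSpace.proj j).comp (ContinuousLinearMap.snd ℝ _ _))
  let g : Fin d → (V d × V d) × ((V d × V d) →L[ℝ] ℝ) := fun j ↦
    ((0, EuclideanSpace.single j 1), (EuclideanSpace.proj j).comp (ContinuousLinearMap.fst ℝ _ _))
  (List.ofFn f ++ List.ofFn f) ++ (List.ofFn g ++ List.ofFn g)

theorem fderiv_phase_of_mem_phaseList {p : (V d × V d) × ((V d × V d) →L[ℝ] ℝ)}
    (hp : p ∈ phaseList d) (z : V d × V d) :
    fderiv ℝ phase z p.1 = 2 * Real.pi * Complex.I * p.2 z * phase z := by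
  simp only [phaseList, List.mem_append, or_self, List.mem_ofFn] at hp
  rw [fderiv_phase]
  rcases hp with ⟨j, rfl⟩ | ⟨j, rfl⟩ <;>
  simp [EuclideanSpace.inner_single_left, EuclideanSpace.inner_single_right]

/-- Two resolvents per coordinate give `(1 + x²)⁻¹`, which is integrable; a single one would decay
only like `|x|⁻¹`. -/
theorem regularizeWeight_phaseList (z : V d × V d) : regularizeWeight (phaseList d) z =
    (∏ j, (1 + z.1 j ^ 2)⁻¹) * ∏ j, (1 + z.2 j ^ 2)⁻¹ := by
  have hproj : ∀ (j : Fin d) (x : V d), EuclideanSpace.proj (𝕜 := ℝ) j x = x j := fun _ _ ↦ rfl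
  simp only [regularizeWeight, phaseList, List.map_append, List.prod_append, List.map_ofFn,
    List.prod_ofFn, Function.comp_apply, resolvent, ContinuousLinearMap.comp_apply,
    ContinuousLinearMap.coe_fst', ContinuousLinearMap.coe_snd', hproj, ← pow_two,
    ← Finset.prod_pow, norm_inv_one_add_mul_I_sq]
  exact mul_comm _ _

theorem integrable_prod_inv_one_add_sq :
    Integrable (fun v : V d ↦ ∏ j, (1 + v j ^ 2)⁻¹) := by
  have h : Integrable (fun x : Fin d → ℝ ↦ ∏ j, (1 + x j ^ 2)⁻¹) :=
    Integrable.fintype_prod (f := fun _ : Fin d ↦ fun x : ℝ ↦ (1 + x ^ 2)⁻¹)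
      (μ := fun _ ↦ volume) fun _ ↦ integrable_inv_one_add_sq
  exact (PiLp.volume_preserving_ofLp (Fin d)).integrable_comp_of_integrable h

theorem integrable_regularizeWeight_phaseList :
    Integrable (regularizeWeight (phaseList d)) := by
  rw [funext regularizeWeight_phaseList]
  exact integrable_prod_inv_one_add_sq.mul_prod integrable_prod_inv_one_add_sq

end Phase

/-! ### The oscillating integral of the constant one. -/

section OscValue

variable {d : ℕ} {ι A : Type*} [NormedAddCommGroup A] [NormedSpace ℂ A]

/-- The absolutely convergent expression of the oscillating integral of `F`. -/
noncomputable def regularizedIntegral (F : V d × V d → A) : A :=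
  ∫ z, phase z • regularizeList (phaseList d) F z

theorem tendsto_integral_phase {f : Filter ι} [f.IsCountablyGenerated]
    {Φ : ι → V d × V d → ℂ} (hΦ : IsSymbolFamily (fun _ ↦ 1) Φ)
    (hΦc : ∀ i, HasCompactSupport (Φ i)) (hΦ1 : ∀ z, ∀ᶠ i in f, Φ i =ᶠ[𝓝 z] fun _ ↦ 1)
    {F : V d × V d → A} (hF : IsSymbolFamily (fun _ ↦ 1) (fun _ : Unit ↦ F)) :
    Tendsto (fun i ↦ ∫ z, (Φ i z * phase z) • F z) f (𝓝 (regularizedIntegral F)) := by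
  have : (volume : Measure (V d × V d)).IsAddHaarMeasure :=
    inferInstanceAs ((volume : Measure (V d)).prod (volume : Measure (V d))).IsAddHaarMeasure
  exact tendsto_integral_cutoff volume contDiff_phase (fun z ↦ (norm_phase z).le)
    (fun _ hp ↦ fderiv_phase_of_mem_phaseList hp) integrable_regularizeWeight_phaseList hΦ hΦc hΦ1
    hF

theorem isSymbolFamily_const (c : A) :
    IsSymbolFamily (fun _ ↦ 1) (fun _ : Unit ↦ fun _ : V d × V d ↦ c) where
  contDiff _ := contDiff_const
  bound k := by
    rcases Nat.eq_zero_or_pos k with rfl | hk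
    · exact ⟨‖c‖, norm_nonneg _, fun _ _ ↦ by simp⟩
    · exact ⟨0, le_rfl, fun _ _ ↦ by rw [iteratedFDeriv_const_of_ne hk.ne']; simp⟩

/-- A smooth compactly supported cutoff equal to `1` near the origin. -/
theorem exists_cutoff (d : ℕ) : ∃ χ : V d → ℂ, ContDiff ℝ ∞ χ ∧ HasCompactSupport χ ∧
    ∀ x ∈ Metric.ball (0 : V d) 1, χ x = 1 := by
  let b : ContDiffBump (0 : V d) := ⟨1, 2, one_pos, one_lt_two⟩
  refine ⟨fun x ↦ (b x : ℂ), Complex.ofRealCLM.contDiff.comp b.contDiff,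
    b.hasCompactSupport.comp_left (g := fun x : ℝ ↦ (x : ℂ)) rfl, fun x hx ↦ ?_⟩
  simp only [b.one_of_mem_closedBall (Metric.ball_subset_closedBall hx), Complex.ofReal_one]

open FourierTransform in
-- The inner integral is the inverse Fourier transform of `χ`, a Schwartz function; its total
-- integral is its Fourier transform at `0`, so inversion gives `χ 0`.
theorem integral_integral_phase {χ : V d → ℂ} (hχ : ContDiff ℝ ∞ χ) (hc : HasCompactSupport χ) :
    Integrable (fun v ↦ ∫ u, phase (u, v) * χ u) ∧ ∫ v, ∫ u, phase (u, v) * χ u = χ 0 := by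
  have hinv : (fun v ↦ ∫ u, phase (u, v) * χ u) = 𝓕⁻ χ := by
    funext v
    rw [Real.fourierInv_eq']
    refine integral_congr_ae (Eventually.of_forall fun u ↦ ?_)
    simp only [phase, smul_eq_mul]
    push_cast
    ring_nf
  have hS1 : 𝓕⁻ χ = ⇑(𝓕⁻ (hc.toSchwartzMap hχ) : SchwartzMap (V d) ℂ) := (SchwartzMap.fourierInv_coe (hc.toSchwartzMap hχ)).symm
  have hS2 : 𝓕 χ = ⇑(𝓕 (hc.toSchwartzMap hχ) : SchwartzMap (V d) ℂ) := SchwartzMap.fourier_coe (hc.toSchwartzMap hχ)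
  have hint : Integrable (𝓕⁻ χ) := hS1 ▸ SchwartzMap.integrable _
  rw [hinv]
  refine ⟨hint, ?_⟩
  have h := congrFun (hχ.continuous.fourier_fourierInv_eq
    (hχ.continuous.integrable_of_hasCompactSupport hc) (hS2 ▸ SchwartzMap.integrable _)) 0
  rw [Real.fourier_eq'] at h
  simpa using h

/-- Dilation factors `(σ i + 1)⁻¹ ≤ 1` can only shrink derivatives, so the bounds for `χ` itself are
uniform in the scale. -/
theorem isSymbolFamily_dilate {χ : V d → ℂ} (hχ : ContDiff ℝ ∞ χ) (hc : HasCompactSupport χ)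
    {E : Type*} [NormedAddCommGroup E] [NormedSpace ℝ E] {L : E →L[ℝ] V d} (hL : ‖L‖ ≤ 1)
    {κ : Type*} (σ : κ → ℕ) :
    IsSymbolFamily (fun _ ↦ 1) (fun i z ↦ χ (((σ i + 1 : ℝ)⁻¹) • L z)) := by
  refine ((isSymbolFamily_of_hasCompactSupport hχ hc).congr_index fun _ : κ ↦ ()).comp_clm
    (L := fun i ↦ ((σ i + 1 : ℝ)⁻¹) • L) (M := 1) (fun _ ↦ zero_le_one) (fun i ↦ ?_)
    (fun _ _ ↦ le_rfl)
  rw [norm_smul, norm_inv, Real.norm_of_nonneg (by positivity : (0 : ℝ) ≤ σ i + 1)]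
  exact mul_le_one₀ (inv_le_one_of_one_le₀ (by simp)) (norm_nonneg _) hL

theorem eventually_dilate_eq_one {χ : V d → ℂ} (hχ1 : ∀ x ∈ Metric.ball (0 : V d) 1, χ x = 1)
    (x : V d) : ∀ᶠ m : ℕ in atTop, ∀ᶠ y in 𝓝 x, χ ((m + 1 : ℝ)⁻¹ • y) = 1 := by
  filter_upwards [tendsto_natCast_atTop_atTop.eventually_gt_atTop (‖x‖ + 1)] with m hm
  filter_upwards [Metric.ball_mem_nhds x one_pos] with y hy
  refine hχ1 _ ?_
  have hy' : ‖y‖ < ‖x‖ + 1 := by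
    have := norm_le_norm_add_norm_sub x y
    rw [← dist_eq_norm] at this
    linarith [Metric.mem_ball'.1 hy]
  rw [mem_ball_zero_iff, norm_smul, norm_inv,
    Real.norm_of_nonneg (by positivity : (0 : ℝ) ≤ m + 1), inv_mul_lt_iff₀ (by positivity)]
  linarith

theorem eq_of_tendsto_prod_of_tendsto {X : Type*} [TopologicalSpace X] [T2Space X]
    {α β : Type*} {f : Filter α} {g : Filter β} [f.NeBot] [g.NeBot] {F : α × β → X} {a b : X}
    (h : Tendsto F (f ×ˢ g) (𝓝 a)) (h' : ∀ x, Tendsto (fun y ↦ F (x, y)) g (𝓝 b)) : a = b := by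
  by_contra hab
  obtain ⟨s, t, hs, ht, has, hbt, hst⟩ := t2_separation hab
  obtain ⟨x, hx⟩ := (h.eventually (hs.mem_nhds has)).curry.exists
  obtain ⟨y, hy, hy'⟩ := (hx.and ((h' x).eventually (ht.mem_nhds hbt))).exists
  exact Set.disjoint_left.1 hst hy hy'

/-- Cutoffs in `u` and `v` get independent scales `m` and `k`. The joint limit is the regularized
integral, while for fixed `m` the limit in `k` is already `χ 0 = 1` by Fourier inversion. -/
theorem regularizedIntegral_one : regularizedIntegral (fun _ : V d × V d ↦ (1 : ℂ)) = 1 := by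
  obtain ⟨χ, hχ, hc, hχ1⟩ := exists_cutoff d
  have hχs : ∀ m : ℕ, ContDiff ℝ ∞ fun x : V d ↦ χ ((m + 1 : ℝ)⁻¹ • x) := fun m ↦
    hχ.comp (contDiff_id.const_smul _)
  have hcs : ∀ m : ℕ, HasCompactSupport fun x : V d ↦ χ ((m + 1 : ℝ)⁻¹ • x) := fun m ↦
    hc.comp_smul (by positivity)
  have hfst : ‖ContinuousLinearMap.fst ℝ (V d) (V d)‖ ≤ 1 := ContinuousLinearMap.norm_fst_le ..
  have hsnd : ‖ContinuousLinearMap.snd ℝ (V d) (V d)‖ ≤ 1 := ContinuousLinearMap.norm_snd_le ..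
  let Φ : ℕ × ℕ → V d × V d → ℂ := fun m z ↦
    χ ((m.1 + 1 : ℝ)⁻¹ • z.1) * χ ((m.2 + 1 : ℝ)⁻¹ • z.2)
  have hΦ : IsSymbolFamily (fun _ ↦ 1) Φ := by
    simpa using! (isSymbolFamily_dilate hχ hc hfst Prod.fst).bilinear (fun _ ↦ zero_le_one)
      (isSymbolFamily_dilate hχ hc hsnd Prod.snd) (ContinuousLinearMap.mul ℝ ℂ)
  have hΦc : ∀ m, HasCompactSupport (Φ m) := fun m ↦
    HasCompactSupport.intro ((hcs m.1).isCompact.prod (hcs m.2).isCompact) fun z hz ↦ by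
      rw [Set.mem_prod, not_and_or] at hz
      rcases hz with hz | hz
      · have := image_eq_zero_of_notMem_tsupport hz
        simp only [Φ, this, zero_mul]
      · have := image_eq_zero_of_notMem_tsupport hz
        simp only [Φ, this, mul_zero]
  have hΦ1 : ∀ z, ∀ᶠ m in atTop ×ˢ atTop, Φ m =ᶠ[𝓝 z] fun _ ↦ 1 := fun z ↦ by
    filter_upwards [(eventually_dilate_eq_one hχ1 z.1).prod_mk
      (eventually_dilate_eq_one hχ1 z.2)] with m hm
    rw [nhds_prod_eq]
    filter_upwards [hm.1.prod_mk hm.2] with y hy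
    simp only [Φ, hy.1, hy.2, mul_one]
  refine eq_of_tendsto_prod_of_tendsto
    (tendsto_integral_phase hΦ hΦc hΦ1 (isSymbolFamily_const 1)) fun m ↦ ?_
  obtain ⟨hint, hval⟩ := integral_integral_phase (hχs m) (hcs m)
  have hFub : ∀ k : ℕ, ∫ z, (Φ (m, k) z * phase z) • (1 : ℂ) =
      ∫ v, χ ((k + 1 : ℝ)⁻¹ • v) * ∫ u, phase (u, v) * χ ((m + 1 : ℝ)⁻¹ • u) := fun k ↦ by
    have hi : Integrable (fun z ↦ (Φ (m, k) z * phase z) • (1 : ℂ))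
        ((volume : Measure (V d)).prod volume) := by
      have hcont : Continuous fun z ↦ (Φ (m, k) z * phase z) • (1 : ℂ) :=
        ((hΦ.contDiff _).continuous.mul contDiff_phase.continuous).smul continuous_const
      exact hcont.integrable_of_hasCompactSupport ((hΦc (m, k)).mul_right.smul_right)
    rw [Measure.volume_eq_prod, integral_prod_symm _ hi]
    refine integral_congr_ae (Eventually.of_forall fun v ↦ ?_)
    simp only [← integral_const_mul]
    refine integral_congr_ae (Eventually.of_forall fun u ↦ ?_)
    simp only [Φ, smul_eq_mul]
    ring
  simp only [hFub]
  obtain ⟨C, hC⟩ := hχ.continuous.bounded_above_of_compact_support hc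
  have h1 : χ ((m + 1 : ℝ)⁻¹ • 0) = 1 := by
    rw [smul_zero]; exact hχ1 0 (Metric.mem_ball_self one_pos)
  rw [h1] at hval
  rw [← hval]
  refine tendsto_integral_of_dominated_convergence
    (fun v ↦ C * ‖∫ u, phase (u, v) * χ ((m + 1 : ℝ)⁻¹ • u)‖) (fun k ↦ ?_) (hint.norm.const_mul C)
    (fun k ↦ Eventually.of_forall fun v ↦ ?_) (Eventually.of_forall fun v ↦ ?_)
  · exact (hχs k).continuous.aestronglyMeasurable.mul hint.aestronglyMeasurable
  · rw [norm_mul]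
    exact mul_le_mul_of_nonneg_right (hC _) (norm_nonneg _)
  · refine tendsto_const_nhds.congr' ?_
    filter_upwards [eventually_dilate_eq_one hχ1 v] with k hk
    rw [hk.self_of_nhds, one_mul]

end OscValue

/-! ### Lattice partitions of unity as symbol-bounded cutoffs. -/

section Lattice

variable {d : ℕ}

theorem latticePoint_sub (w w' : (Fin d → ℤ) × (Fin d → ℤ)) :
    latticePoint (w - w') = latticePoint w - latticePoint w' := by
  ext i <;> simp [latticePoint]

theorem finite_setOf_norm_latticePoint_le (R : ℝ) :
    {w : (Fin d → ℤ) × (Fin d → ℤ) | ‖latticePoint w‖ ≤ R}.Finite := by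
  refine ((Set.finite_Icc (fun _ : Fin d ↦ -⌈R⌉) (fun _ ↦ ⌈R⌉)).prod
    (Set.finite_Icc (fun _ : Fin d ↦ -⌈R⌉) (fun _ ↦ ⌈R⌉))).subset fun w hw ↦ ?_
  have h1 : ∀ i, |(w.1 i : ℝ)| ≤ ⌈R⌉ := fun i ↦ by
    have h := (PiLp.norm_apply_le (latticePoint w).1 i).trans ((norm_fst_le _).trans hw)
    exact h.trans (Int.le_ceil R)
  have h2 : ∀ i, |(w.2 i : ℝ)| ≤ ⌈R⌉ := fun i ↦ by
    have h := (PiLp.norm_apply_le (latticePoint w).2 i).trans ((norm_snd_le _).trans hw)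
    exact h.trans (Int.le_ceil R)
  simp only [abs_le] at h1 h2
  exact ⟨⟨fun i ↦ by exact_mod_cast (h1 i).1, fun i ↦ by exact_mod_cast (h1 i).2⟩,
    ⟨fun i ↦ by exact_mod_cast (h2 i).1, fun i ↦ by exact_mod_cast (h2 i).2⟩⟩

/-- Finite sums of lattice translates of a compactly supported bounded function are uniformly
bounded. -/
theorem exists_sum_translate_le {h : V d × V d → ℝ} {R C : ℝ} (hC : ∀ z, h z ≤ C)
    (hR : ∀ z, R < ‖z‖ → h z = 0) :
    ∃ M : ℝ, 0 ≤ M ∧ ∀ (s : Finset ((Fin d → ℤ) × (Fin d → ℤ))) (z : V d × V d),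
      ∑ w ∈ s, h (z - latticePoint w) ≤ M := by
  classical
  set T := (finite_setOf_norm_latticePoint_le (d := d) (2 * R)).toFinset with hT
  refine ⟨T.card * |C|, by positivity, fun s z ↦ ?_⟩
  set W := s.filter fun w ↦ ‖z - latticePoint w‖ ≤ R with hW
  have hsum : ∑ w ∈ s, h (z - latticePoint w) = ∑ w ∈ W, h (z - latticePoint w) := by
    rw [hW, Finset.sum_filter_of_ne]
    intro w _ hw
    by_contra hlt
    exact hw (hR _ (not_le.1 hlt))
  -- Subtracting one contributing point injects the contributing points into the lattice points of
  -- norm at most `2R`, a bound independent of `z` and `s`.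
  have hcard : W.card ≤ T.card := by
    rcases W.eq_empty_or_nonempty with h0 | ⟨w₀, hw₀⟩
    · simp [h0]
    · refine Finset.card_le_card_of_injOn (fun w ↦ w - w₀) (fun w hw ↦ ?_)
        (fun w _ w' _ h ↦ sub_left_injective h)
      have h1 := (Finset.mem_filter.1 hw).2
      have h2 := (Finset.mem_filter.1 hw₀).2
      simp only [hT, Set.Finite.coe_toFinset, Set.mem_ofPred_eq, latticePoint_sub]
      calc ‖latticePoint w - latticePoint w₀‖
          = ‖(z - latticePoint w₀) - (z - latticePoint w)‖ := by congr 1; abel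
        _ ≤ _ := norm_sub_le _ _
        _ ≤ 2 * R := by linarith
  calc ∑ w ∈ s, h (z - latticePoint w) = _ := hsum
    _ ≤ ∑ _w ∈ W, |C| := Finset.sum_le_sum fun w _ ↦ (hC _).trans (le_abs_self C)
    _ = W.card * |C| := by simp
    _ ≤ T.card * |C| := by gcongr

variable {φ : V d × V d → ℝ} (hφ : IsPartitionGenerator φ)
include hφ

theorem IsPartitionGenerator.exists_radius : ∃ R : ℝ, ∀ z, R < ‖z‖ → z ∉ tsupport φ := by
  obtain ⟨R, hR⟩ := hφ.hasCompactSupport.isCompact.isBounded.exists_norm_le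
  exact ⟨R, fun z hz h ↦ (hR z h).not_gt hz⟩

/-- Indexing by finite sets makes the partial sums cutoffs along `atTop`, the filter of
unconditional convergence. -/
theorem IsPartitionGenerator.isSymbolFamily :
    IsSymbolFamily (fun _ ↦ 1) fun (s : Finset ((Fin d → ℤ) × (Fin d → ℤ))) (z : V d × V d) ↦
      ∑ w ∈ s, (φ (z - latticePoint w) : ℂ) := by
  have hsm : ContDiff ℝ ∞ fun z ↦ (φ z : ℂ) := Complex.ofRealCLM.contDiff.comp hφ.smooth
  have hc : HasCompactSupport fun z ↦ (φ z : ℂ) :=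
    hφ.hasCompactSupport.comp_left (g := fun x : ℝ ↦ (x : ℂ)) rfl
  have htr : ∀ w, ContDiff ℝ ∞ fun z : V d × V d ↦ (φ (z - latticePoint w) : ℂ) := fun w ↦
    hsm.comp (contDiff_id.sub contDiff_const)
  refine ⟨fun s ↦ ContDiff.sum fun w _ ↦ htr w, fun k ↦ ?_⟩
  have hk : ((k : ℕ∞) : WithTop ℕ∞) ≤ ∞ := by exact_mod_cast le_top
  obtain ⟨C, hC⟩ := (hsm.continuous_iteratedFDeriv hk).bounded_above_of_compact_support
    (hc.iteratedFDeriv k)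
  obtain ⟨R, hR⟩ := (hc.iteratedFDeriv (𝕜 := ℝ) k).isCompact.isBounded.exists_norm_le
  obtain ⟨M, hM, hsum⟩ := exists_sum_translate_le
    (h := fun z ↦ ‖iteratedFDeriv ℝ k (fun z ↦ (φ z : ℂ)) z‖) hC (R := R) fun z hz ↦ by
      rw [image_eq_zero_of_notMem_tsupport fun h ↦ (hR z h).not_gt hz, norm_zero]
  refine ⟨M, hM, fun s z ↦ ?_⟩
  rw [iteratedFDeriv_sum fun w _ ↦ (htr w).of_le hk, mul_one, Finset.sum_apply]
  refine (norm_sum_le _ _).trans ((Finset.sum_le_sum fun w _ ↦ le_of_eq ?_).trans (hsum s z))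
  rw [iteratedFDeriv_comp_sub (f := fun z ↦ (φ z : ℂ))]

theorem IsPartitionGenerator.eventually_sum_eq_one (z : V d × V d) :
    ∀ᶠ s : Finset ((Fin d → ℤ) × (Fin d → ℤ)) in atTop,
      (fun y ↦ ∑ w ∈ s, (φ (y - latticePoint w) : ℂ)) =ᶠ[𝓝 z] fun _ ↦ 1 := by
  obtain ⟨R, hR⟩ := hφ.exists_radius
  -- It suffices that `s` contain every `w` whose translated support can meet the unit ball around
  -- `z`.
  filter_upwards [eventually_ge_atTop
    (finite_setOf_norm_latticePoint_le (d := d) (R + (‖z‖ + 1))).toFinset] with s hs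
  filter_upwards [Metric.ball_mem_nhds z one_pos] with y hy
  have hy' : ‖y‖ < ‖z‖ + 1 := by
    have := norm_le_norm_add_norm_sub z y
    rw [← dist_eq_norm] at this
    linarith [Metric.mem_ball'.1 hy]
  have h0 : ∀ w ∉ s, φ (y - latticePoint w) = 0 := fun w hw ↦ by
    refine image_eq_zero_of_notMem_tsupport (hR _ ?_)
    have h1 : R + (‖z‖ + 1) < ‖latticePoint w‖ := by
      by_contra hle
      exact hw (hs (by simpa using hle))
    have h2 := norm_sub_norm_le (latticePoint w) y
    rw [norm_sub_rev] at h2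
    linarith
  have h1 := (hasSum_sum_of_ne_finset_zero h0).unique (hφ.hasSum_one y)
  rw [← Complex.ofReal_sum, h1, Complex.ofReal_one]

theorem IsPartitionGenerator.hasCompactSupport_translate (w : (Fin d → ℤ) × (Fin d → ℤ)) :
    HasCompactSupport fun z : V d × V d ↦ (φ (z - latticePoint w) : ℂ) :=
  (hφ.hasCompactSupport.comp_left (g := fun x : ℝ ↦ (x : ℂ)) rfl).comp_homeomorph
    (Homeomorph.subRight (latticePoint w))

theorem IsPartitionGenerator.integrable {A : Type*} [NormedAddCommGroup A] [NormedSpace ℂ A]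
    {F : V d × V d → A} (hF : Continuous F) (w : (Fin d → ℤ) × (Fin d → ℤ)) :
    Integrable fun z : V d × V d ↦ ((φ (z - latticePoint w) : ℂ) * phase z) • F z := by
  have hcont : Continuous fun z : V d × V d ↦ ((φ (z - latticePoint w) : ℂ) * phase z) • F z :=
    ((Complex.continuous_ofReal.comp
      (hφ.smooth.continuous.comp (continuous_id.sub continuous_const))).mul
      contDiff_phase.continuous).smul hF
  exact hcont.integrable_of_hasCompactSupport
    (hφ.hasCompactSupport_translate w).mul_right.smul_right

/-- The oscillating integral of a function with bounded derivatives exists. -/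
theorem IsPartitionGenerator.hasSum_integral {A : Type*} [NormedAddCommGroup A] [NormedSpace ℂ A]
    {F : V d × V d → A} (hF : IsSymbolFamily (fun _ ↦ 1) (fun _ : Unit ↦ F)) :
    HasSum (fun w ↦ ∫ z : V d × V d, ((φ (z - latticePoint w) : ℂ) *
        Complex.exp (2 * Real.pi * Complex.I * ((inner ℝ z.1 z.2 : ℝ) : ℂ))) • F z)
      (regularizedIntegral F) := by
  have hc : ∀ s : Finset ((Fin d → ℤ) × (Fin d → ℤ)),
      HasCompactSupport fun z : V d × V d ↦ ∑ w ∈ s, (φ (z - latticePoint w) : ℂ) := fun s ↦ by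
    classical
    induction s using Finset.induction_on with
    | empty =>
      simp only [Finset.sum_empty]
      exact HasCompactSupport.zero
    | insert a s ha ih =>
      simp only [Finset.sum_insert ha]
      exact (hφ.hasCompactSupport_translate a).add ih
  have h := tendsto_integral_phase (f := atTop) hφ.isSymbolFamily hc hφ.eventually_sum_eq_one hF
  rw [HasSum, SummationFilter.unconditional_filter]
  refine h.congr fun s ↦ ?_
  rw [← integral_finsetSum]
  · refine integral_congr_ae (Eventually.of_forall fun z ↦ ?_)
    simp only [Finset.sum_mul, Finset.sum_smul, phase]
  · exact fun w _ ↦ hφ.integrable (hF.contDiff ()).continuous w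

end Lattice

/-! ### Existence of a lattice partition of unity. -/

section Existence

/-- A smooth compactly supported function on `ℝ` whose integer translates sum to `1`. -/
noncomputable def unitPartition (x : ℝ) : ℝ :=
  Real.smoothTransition (x + 1) - Real.smoothTransition x

theorem unitPartition_eq_zero {x : ℝ} (hx : x ≤ -1 ∨ 1 ≤ x) : unitPartition x = 0 := by
  rcases hx with hx | hx
  · simp [unitPartition, Real.smoothTransition.zero_of_nonpos (by linarith : x + 1 ≤ 0),
      Real.smoothTransition.zero_of_nonpos (by linarith : x ≤ 0)]
  · simp [unitPartition, Real.smoothTransition.one_of_one_le (by linarith : 1 ≤ x + 1),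
      Real.smoothTransition.one_of_one_le hx]

theorem unitPartition_nonneg (x : ℝ) : 0 ≤ unitPartition x :=
  sub_nonneg.2 (Real.smoothTransition.monotone (by linarith))

theorem contDiff_unitPartition : ContDiff ℝ ∞ unitPartition :=
  (Real.smoothTransition.contDiff.comp (contDiff_id.add contDiff_const)).sub
    Real.smoothTransition.contDiff

/-- The two terms telescope to a transition value at an argument `≥ 1` minus one at an argument `≤
0`. -/
theorem sum_unitPartition (x : ℝ) :
    ∑ k ∈ ({⌊x⌋, ⌊x⌋ + 1} : Finset ℤ), unitPartition (x - k) = 1 := by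
  rw [Finset.sum_pair (by omega)]
  have h1 := Int.floor_le x
  have h2 := Int.lt_floor_add_one x
  simp only [unitPartition]
  rw [Real.smoothTransition.one_of_one_le (by linarith : 1 ≤ x - ⌊x⌋ + 1),
    Real.smoothTransition.zero_of_nonpos (by push_cast; linarith : x - ((⌊x⌋ + 1 : ℤ) : ℝ) ≤ 0)]
  push_cast
  rw [show x - (⌊x⌋ + 1 : ℝ) + 1 = x - ⌊x⌋ by ring]
  ring

theorem unitPartition_sub_eq_zero {x : ℝ} {k : ℤ}
    (hk : k ∉ ({⌊x⌋, ⌊x⌋ + 1} : Finset ℤ)) : unitPartition (x - k) = 0 := by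
  simp only [Finset.mem_insert, Finset.mem_singleton, not_or] at hk
  refine unitPartition_eq_zero ?_
  have h1 := Int.floor_le x
  have h2 := Int.lt_floor_add_one x
  rcases lt_trichotomy k ⌊x⌋ with h | h | h
  · right
    have : (k : ℝ) + 1 ≤ ⌊x⌋ := by exact_mod_cast h
    linarith
  · exact absurd h hk.1
  · left
    have : (⌊x⌋ : ℝ) + 2 ≤ k := by
      have : ⌊x⌋ + 2 ≤ k := by omega
      exact_mod_cast this
    linarith

/-- `HasOscIntegral` quantifies over all generators, so without one every `a` would qualify and the
chosen value would be undetermined. -/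
theorem exists_isPartitionGenerator (d : ℕ) : ∃ φ : V d × V d → ℝ, IsPartitionGenerator φ := by
  classical
  refine ⟨fun z ↦ (∏ j, unitPartition (z.1 j)) * ∏ j, unitPartition (z.2 j), ?_, ?_, ?_, ?_⟩
  · refine ContDiff.mul (contDiff_prod fun j _ ↦ ?_) (contDiff_prod fun j _ ↦ ?_)
    · exact contDiff_unitPartition.comp
        ((EuclideanSpace.proj (𝕜 := ℝ) j : V d →L[ℝ] ℝ).contDiff.comp contDiff_fst)
    · exact contDiff_unitPartition.comp
        ((EuclideanSpace.proj (𝕜 := ℝ) j : V d →L[ℝ] ℝ).contDiff.comp contDiff_snd)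
  · have hQ : IsCompact (WithLp.toLp 2 '' (Set.univ.pi fun _ : Fin d ↦ Icc (-1 : ℝ) 1)) :=
      (isCompact_univ_pi fun _ ↦ isCompact_Icc).image (PiLp.continuous_toLp 2 _)
    have h0 : ∀ x : V d, x ∉ WithLp.toLp 2 '' (Set.univ.pi fun _ : Fin d ↦ Icc (-1 : ℝ) 1) →
        ∏ j, unitPartition (x j) = 0 := fun x hx ↦ by
      have : ¬ ∀ j, x j ∈ Icc (-1 : ℝ) 1 := fun h ↦
        hx ⟨WithLp.ofLp x, fun j _ ↦ h j, rfl⟩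
      push Not at this
      obtain ⟨j, hj⟩ := this
      refine Finset.prod_eq_zero (Finset.mem_univ j) (unitPartition_eq_zero ?_)
      rw [Set.mem_Icc, not_and_or, not_le, not_le] at hj
      exact hj.imp le_of_lt le_of_lt
    refine HasCompactSupport.intro (hQ.prod hQ) fun z hz ↦ ?_
    rw [Set.mem_prod, not_and_or] at hz
    rcases hz with hz | hz
    · rw [h0 _ hz, zero_mul]
    · rw [h0 _ hz, mul_zero]
  · exact fun z ↦ mul_nonneg (Finset.prod_nonneg fun _ _ ↦ unitPartition_nonneg _)
      (Finset.prod_nonneg fun _ _ ↦ unitPartition_nonneg _)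
  · intro z
    let T : V d → Finset (Fin d → ℤ) := fun x ↦
      Fintype.piFinset fun j ↦ ({⌊x j⌋, ⌊x j⌋ + 1} : Finset ℤ)
    have hT : ∀ x : V d, ∑ k ∈ T x, ∏ j, unitPartition (x j - k j) = 1 := fun x ↦ by
      rw [← Finset.prod_univ_sum (fun j ↦ ({⌊x j⌋, ⌊x j⌋ + 1} : Finset ℤ))
        (fun j k ↦ unitPartition (x j - k))]
      exact Finset.prod_eq_one fun j _ ↦ sum_unitPartition _
    have hT0 : ∀ (x : V d) (k : Fin d → ℤ), k ∉ T x → ∏ j, unitPartition (x j - k j) = 0 :=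
      fun x k hk ↦ by
        simp only [T, Fintype.mem_piFinset, not_forall] at hk
        obtain ⟨j, hj⟩ := hk
        exact Finset.prod_eq_zero (Finset.mem_univ j) (unitPartition_sub_eq_zero hj)
    have h1 : ∑ w ∈ T z.1 ×ˢ T z.2, (∏ j, unitPartition (z.1 j - w.1 j)) *
        ∏ j, unitPartition (z.2 j - w.2 j) = 1 := by
      simp only [Finset.sum_product, ← Finset.mul_sum, hT, mul_one]
    rw [← h1]
    refine hasSum_sum_of_ne_finset_zero fun w hw ↦ ?_
    rw [Finset.mem_product, not_and_or] at hw
    change (∏ j, unitPartition (z.1 j - w.1 j)) * ∏ j, unitPartition (z.2 j - w.2 j) = 0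
    rcases hw with hw | hw
    · rw [hT0 _ _ hw, zero_mul]
    · rw [hT0 _ _ hw, mul_zero]

end Existence

/-! ### Application to the deformed product. -/

section Action

variable {n d : ℕ} {N : Type*} [TopologicalSpace N]
  [ChartedSpace (EuclideanSpace ℝ (Fin n)) N]
  {X : Fin d → (x : N) → TangentSpace (𝓡 n) x}

theorem isSymbolFamily_action (hcont : ∀ v : V d, Continuous (jointFlow X v))
    (hadd : ∀ v w : V d, jointFlow X (v + w) = jointFlow X v ∘ jointFlow X w) {f : N →ᵇ ℂ}
    (hf : f ∈ smoothVectors X) :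
    IsSymbolFamily (fun _ ↦ 1) (fun (_ : Unit) (v : V d) ↦ action X v f) where
  contDiff _ := hf
  bound k := ⟨_, norm_nonneg _, fun _ v ↦ by
    rw [mul_one]
    exact norm_iteratedFDeriv_action_le hcont hadd hf k v⟩

theorem isSymbolFamily_starIntegrand (hcont : ∀ v : V d, Continuous (jointFlow X v))
    (hadd : ∀ v w : V d, jointFlow X (v + w) = jointFlow X v ∘ jointFlow X w)
    (Θ : V d →ₗ[ℝ] V d) {f g : N →ᵇ ℂ} (hf : f ∈ smoothVectors X) (hg : g ∈ smoothVectors X) :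
    IsSymbolFamily (fun _ ↦ 1) (fun _ : Unit ↦ starIntegrand X Θ f g) := by
  have h1 := (isSymbolFamily_action hcont hadd hf).comp_clm (fun _ ↦ zero_le_one)
    (L := fun _ ↦ (LinearMap.toContinuousLinearMap Θ).comp (ContinuousLinearMap.fst ℝ (V d) (V d)))
    (fun _ ↦ le_rfl) (τ := fun _ ↦ 1) (fun _ _ ↦ le_rfl)
  have h2 := (isSymbolFamily_action hcont hadd hg).comp_clm (fun _ ↦ zero_le_one)
    (L := fun _ ↦ ContinuousLinearMap.snd ℝ (V d) (V d))
    (fun _ ↦ le_rfl) (τ := fun _ ↦ 1) (fun _ _ ↦ le_rfl)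
  have h := h1.bilinear (fun _ ↦ zero_le_one) h2 (ContinuousLinearMap.mul ℝ (N →ᵇ ℂ))
  simp only [mul_one] at h
  exact h

end Action

section Integral

variable {d : ℕ} {A : Type*} [NormedAddCommGroup A] [NormedSpace ℂ A]

theorem hasOscIntegral_oscIntegral {F : V d × V d → A}
    (hF : IsSymbolFamily (fun _ ↦ 1) (fun _ : Unit ↦ F)) : HasOscIntegral F (oscIntegral F) := by
  have h : ∃ a, HasOscIntegral F a := ⟨_, fun φ hφ ↦ hφ.hasSum_integral hF⟩
  rw [oscIntegral, dif_pos h]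
  exact h.choose_spec

/-- A continuous linear map which is constant on `F` takes that constant value on the oscillating
integral of `F`. -/
theorem apply_oscIntegral_eq [CompleteSpace A] {F : V d × V d → A}
    (hF : IsSymbolFamily (fun _ ↦ 1) (fun _ : Unit ↦ F)) (L : A →L[ℂ] ℂ) {c : ℂ}
    (hL : ∀ z, L (F z) = c) : L (oscIntegral F) = c := by
  obtain ⟨φ, hφ⟩ := exists_isPartitionGenerator d
  have h1 := (hasOscIntegral_oscIntegral hF φ hφ).mapL L
  -- With the same partition, the series for the constant `1` times `c` agrees term by term with the
  -- image of the series under `L`.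
  have h2 := (hφ.hasSum_integral (isSymbolFamily_const (1 : ℂ))).mul_right c
  rw [regularizedIntegral_one, one_mul] at h2
  refine h1.unique (h2.congr_fun fun w ↦ ?_)
  rw [← integral_mul_const]
  refine (L.integral_comp_comm (hφ.integrable (hF.contDiff ()).continuous w)).symm.trans ?_
  simp only [map_smul, hL, smul_eq_mul, mul_one, phase]

end Integral

section Manifold

variable {n d : ℕ} {N : Type*} [TopologicalSpace N] [T2Space N]
  [ChartedSpace (EuclideanSpace ℝ (Fin n)) N] [IsManifold (𝓡 n) ∞ N]
  {X : Fin d → (x : N) → TangentSpace (𝓡 n) x}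
  (hX : ∀ i, ContMDiff (𝓡 n) (𝓡 n).tangent ∞
    (fun x => (⟨x, X i x⟩ : TangentBundle (𝓡 n) N)))
include hX

theorem jointFlow_eq_self_of_forall_eq_zero {q : N} (hq : ∀ i, X i q = 0) (v : V d) :
    jointFlow X v q = q :=
  jointFlow_induction (P := fun h ↦ h q = q) rfl
    (fun f _ hf hg ↦ (congrArg f hg).trans hf)
    (fun i t ↦ flow_eq_self_of_eq_zero (hX i) (hq i) t) v

variable {K : Set N} (hK : IsCompact K) (hsupp : ∀ i, closure {x | X i x ≠ 0} ⊆ K)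
include hK hsupp

theorem continuous_jointFlow (v : V d) : Continuous (jointFlow X v) :=
  jointFlow_induction continuous_id (fun _ _ h1 h2 ↦ h1.comp h2)
    (fun i t ↦ continuous_flow (hX i) hK (hsupp i) t) v

theorem jointFlow_add_of_mlieBracket_eq_zero
    (hcomm : ∀ i j x, VectorField.mlieBracket (𝓡 n) (X i) (X j) x = 0) (v w : V d) :
    jointFlow X (v + w) = jointFlow X v ∘ jointFlow X w :=
  jointFlow_add
    (fun i s t ↦ funext (flow_add (hX i)
      (exists_isMIntegralCurve_of_support_subset (hX i) hK (hsupp i)) s t))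
    (fun i j s t ↦ funext (flow_comm (hX i) (hX j) (hcomm i j) hK (hsupp i) (hsupp j) s t)) v w

end Manifold

end OscillatoryIntegrals

end RieffelDeformation

open RieffelDeformation in
theorem mainTheorem10 {n d : ℕ} {N : Type*} [TopologicalSpace N] [T2Space N]
    [SecondCountableTopology N] [ChartedSpace (EuclideanSpace ℝ (Fin n)) N]
    [IsManifold (𝓡 n) ∞ N]
    (X : Fin d → (x : N) → TangentSpace (𝓡 n) x)
    (hX : ∀ i, ContMDiff (𝓡 n) (𝓡 n).tangent ∞
      (fun x => (⟨x, X i x⟩ : TangentBundle (𝓡 n) N)))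
    (K : Set N) (hK : IsCompact K)
    (hsupp : ∀ i, closure {x | X i x ≠ 0} ⊆ K)
    (hcomm : ∀ i j x, VectorField.mlieBracket (𝓡 n) (X i) (X j) x = 0)
    (Θ : V d →ₗ[ℝ] V d)
    (hΘ : ∀ u v : V d, inner ℝ (Θ u) v = - inner ℝ u (Θ v))
    (q : N) (hq : (q ∈ K ∧ ∀ i, X i q = 0) ∨ q ∉ K)
    (f g : N →ᵇ ℂ) (hf : f ∈ smoothVectors X) (hg : g ∈ smoothVectors X) :
    HasOscIntegral (starIntegrand X Θ f g) (starProduct X Θ f g) ∧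
      delta q (starProduct X Θ f g) = f q * g q ∧ f q * g q = delta q (f * g) := by
  have hcont := continuous_jointFlow hX hK hsupp
  have hF := isSymbolFamily_starIntegrand hcont
    (jointFlow_add_of_mlieBracket_eq_zero hX hK hsupp hcomm) Θ hf hg
  -- Both cases of the hypothesis on `q` collapse here: outside `K` the fields vanish by the support
  -- condition.
  have hX0 : ∀ i, X i q = 0 := fun i ↦ hq.elim (fun h ↦ h.2 i) fun h ↦
    eq_zero_of_notMem (hsupp i) h
  have haction : ∀ (v : V d) (f : N →ᵇ ℂ), action X v f q = f q := fun v f ↦ by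
    rw [action, dif_pos (hcont v)]
    exact congrArg f (jointFlow_eq_self_of_forall_eq_zero hX hX0 v)
  refine ⟨hasOscIntegral_oscIntegral hF, apply_oscIntegral_eq hF (delta q) fun z ↦ ?_, rfl⟩
  exact congrArg₂ (· * ·) (haction _ f) (haction _ g)
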